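/- Let $K$ be a number field with ring of integers $A$, equipped with the norm $\|a\|_A = \max_{\sigma} |\sigma(a)|_\infty$, where $\sigma$ ranges over all embeddings $K \hookrightarrow \mathbf{C}$ and $|\cdot|_\infty$ is the usual absolute value on $\mathbf{C}$. Let $\mathbf{A}^{1,\mathrm{An}}_{(A,\|\cdot\|_A)}$ be the Berkovich affine line over $(A,\|\cdot\|_A)$, that is, the set of all multiplicative seminorms $|\cdot| \colon A[T] \to \mathbf{R}_{\geq 0}$ (with $|0|=0$ and $|1|=1$) satisfying $|a| \leq \|a\|_A$ for all $a \in A$, equipped with the weakest topology for which $|\cdot| \mapsto |f|$ is continuous for every $f \in A[T]$. Then $\mathbf{A}^{1,\mathrm{An}}_{(A,\|\cdot\|_A)}$ is contractible. -/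

import Mathlib

open scoped NumberField Polynomial

noncomputable section

namespace BerkovichLine

/-- The analytification of the affine scheme `Spec B` over the normed ring `(A, N)`:
the set of multiplicative seminorms on `B` whose restriction to `A` is bounded by `N`. -/
def Analytification {A : Type*} [CommRing A] (N : RingNorm A)
    (B : Type*) [CommRing B] [Algebra A B] : Type _ :=
  {x : MulRingSeminorm B // ∀ a : A, x (algebraMap A B a) ≤ N a}

/-- The weakest topology for which `x ↦ |f(x)|` is continuous for every `f ∈ B`
(the topology of pointwise convergence). -/
instance {A : Type*} [CommRing A] (N : RingNorm A)
    (B : Type*) [CommRing B] [Algebra A B] : TopologicalSpace (Analytification N B) :=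
  ⨅ f : B, TopologicalSpace.induced (fun x : Analytification N B => x.1 f) inferInstance

/-- The Berkovich affine line over the normed ring `(A, N)`: the analytification of
`Spec A[T]` over `(A, N)`. -/
abbrev AffineLine {A : Type*} [CommRing A] (N : RingNorm A) : Type _ :=
  Analytification N A[X]

section RingOfIntegers

variable (K : Type*) [Field K] [NumberField K]

/-- The norm `a ↦ max_σ |σ(a)|_∞` on the ring of integers of a number field `K`, the maximum
being over the finitely many (at least one) embeddings `σ : K → ℂ`. -/
def archimedeanNorm : RingNorm (𝓞 K) where
  toFun a := (Finset.univ : Finset (K →+* ℂ)).sup' Finset.univ_nonempty (fun σ => ‖σ (a : K)‖)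
  map_zero' := by simp
  neg' a := by simp
  add_le' a b := by
    refine Finset.sup'_le _ _ fun σ hσ => ?_
    rw [show ((a + b : 𝓞 K) : K) = (a : K) + (b : K) from map_add (algebraMap (𝓞 K) K) a b, map_add]
    exact (norm_add_le _ _).trans (add_le_add
      (Finset.le_sup' (fun σ : K →+* ℂ => ‖σ (a : K)‖) hσ)
      (Finset.le_sup' (fun σ : K →+* ℂ => ‖σ (b : K)‖) hσ))
  mul_le' a b := by
    refine Finset.sup'_le _ _ fun σ hσ => ?_
    rw [show ((a * b : 𝓞 K) : K) = (a : K) * (b : K) from map_mul (algebraMap (𝓞 K) K) a b,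
      map_mul, norm_mul]
    have ha := Finset.le_sup' (fun σ : K →+* ℂ => ‖σ (a : K)‖) hσ
    exact mul_le_mul ha (Finset.le_sup' (fun σ : K →+* ℂ => ‖σ (b : K)‖) hσ)
      (norm_nonneg _) ((norm_nonneg _).trans ha)
  eq_zero_of_map_eq_zero' a h := by
    obtain ⟨σ⟩ : Nonempty (K →+* ℂ) := inferInstance
    have hle := Finset.le_sup' (fun σ : K →+* ℂ => ‖σ (a : K)‖) (Finset.mem_univ σ)
    have h0 : ‖σ (a : K)‖ = 0 := le_antisymm (hle.trans h.le) (norm_nonneg _)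
    have h1 : (a : K) = 0 := by simpa using h0
    exact_mod_cast h1

end RingOfIntegers

end BerkovichLine

end

/-! The points split into two closed halves: the nonarchimedean ones, `nonarch`, and `archClosure`,
which consists of the archimedean branches and the central fibre, where nonzero constants have value
1. The halves meet in the central fibre `central`. By the classification of archimedean seminorms,
an archimedean point has the form f ↦ |σ(f)(z)|^ε with 0 < ε ≤ 1.

Raising a seminorm to the power t and letting t tend to 0 should lead to the trivial norm, but this
is discontinuous at t = 0 at a seminorm with nonzero kernel. The homotopy `spread` therefore first
removes the kernels over the central fibre. On nonarchimedean points it enlarges the point to a disc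
of radius r (`thicken`), so that T - β gets value max(|T - β|, r). This has to be continued to
nearby archimedean points. Around each algebraic number α there is a collar in which ε decreases
while |z - α|^ε stays fixed, until the trivially valued fibre over ℂ is reached; there the point is
pushed away from the end of the branch at α. Weights on the countable set of algebraic numbers make
the collars disjoint, locally finite for ε > 0, and compatible with thickening as ε tends to 0.
Continuity of `spread` is checked along ultrafilters; in the limit to the central fibre, polynomials
are split over ℂ and only the factors T - β with β algebraic matter.

After `spread`, raising to the power `depth x`, which vanishes exactly on the central fibre, is
continuous and sends the whole central fibre to the trivial point (`collapse`). The two halves can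
then be contracted independently. On the archimedean half ordinary powers work: their limits at t =
0 lie in the central fibre, which is already collapsed. On the nonarchimedean half the disc grows
until it contains the origin, so that the point becomes a Gauss point over its restriction to
constants. The constants are then moved along their branch of the base to the trivial norm
(`raise`), while the radius goes to 1, and the Gauss norm of radius 1 over the trivial norm is
trivial. -/

section

open Polynomial Filter Topology

noncomputable section

namespace BerkovichLine

/-! ### Multiplicative seminorms: powers, limits, and the power trick. -/

section Seminorms

variable {B : Type*} [CommRing B]

/-- A multiplicative seminorm from its defining inequalities. -/
def seminormOf (v : B → ℝ) (h0 : v 0 = 0) (h1 : v 1 = 1) (hnn : ∀ f, 0 ≤ v f)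
    (hmul : ∀ f g, v (f * g) = v f * v g) (hadd : ∀ f g, v (f + g) ≤ v f + v g) :
    MulRingSeminorm B where
  toFun := v
  map_zero' := h0
  map_one' := h1
  map_mul' := hmul
  add_le' := hadd
  neg' f := by
    have h : v (-1) = 1 := by
      have h2 : v (-1) * v (-1) = 1 := by rw [← hmul]; simpa using h1
      nlinarith [hnn (-1)]
    rw [← neg_one_mul, hmul, h, one_mul]

/-- Pullback of a multiplicative seminorm along a ring homomorphism. -/
def seminormComp {B' : Type*} [CommRing B'] (v : MulRingSeminorm B') (φ : B →+* B') :
    MulRingSeminorm B :=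
  seminormOf (fun f => v (φ f)) (by simp) (by simp) (fun _ => apply_nonneg v _) (by simp)
    fun f g => by simpa using map_add_le_add v (φ f) (φ g)

@[simp] lemma seminormComp_apply {B' : Type*} [CommRing B'] (v : MulRingSeminorm B')
    (φ : B →+* B') (f : B) : seminormComp v φ f = v (φ f) := rfl

/-- The `t`-th power of a multiplicative seminorm, the zeroth power being the trivial norm. -/
def seminormPow [IsDomain B] (v : MulRingSeminorm B) (t : ℝ) (ht0 : 0 ≤ t) (ht1 : t ≤ 1) :
    MulRingSeminorm B := by
  classical
  refine seminormOf (fun f => if f = 0 then 0 else v f ^ t) (by simp) (by simp)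
    (fun f => ?_) (fun f g => ?_) fun f g => ?_
  · split_ifs
    exacts [le_rfl, Real.rpow_nonneg (apply_nonneg v f) t]
  · by_cases hf : f = 0
    · simp [hf]
    by_cases hg : g = 0
    · simp [hg]
    simp [hf, hg, Real.mul_rpow (apply_nonneg v f) (apply_nonneg v g)]
  · by_cases hf : f = 0
    · simp [hf]
    by_cases hg : g = 0
    · simp [hg]
    have h2 := Real.rpow_nonneg (apply_nonneg v f) t
    have h3 := Real.rpow_nonneg (apply_nonneg v g) t
    by_cases hfg : f + g = 0
    · simp only [hfg, if_true, hf, hg, if_false]; positivity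
    simp only [hfg, hf, hg, if_false]
    exact (Real.rpow_le_rpow (apply_nonneg v _) (map_add_le_add v f g) ht0).trans
      (Real.rpow_add_le_add_rpow (apply_nonneg v f) (apply_nonneg v g) ht0 ht1)

lemma seminormPow_apply [IsDomain B] (v : MulRingSeminorm B) (t : ℝ) (ht0 : 0 ≤ t) (ht1 : t ≤ 1)
    {f : B} (hf : f ≠ 0) :
    seminormPow v t ht0 ht1 f = v f ^ t := if_neg hf

/-- A pointwise limit of multiplicative seminorms. -/
def seminormLim {ι : Type*} (F : Filter ι) [F.NeBot] (v : ι → MulRingSeminorm B) (l : B → ℝ)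
    (h : ∀ f, Tendsto (fun i => v i f) F (𝓝 (l f))) : MulRingSeminorm B :=
  seminormOf l (tendsto_nhds_unique (h 0) (by simp))
    (tendsto_nhds_unique (h 1) (by simp))
    (fun f => ge_of_tendsto' (h f) fun i => apply_nonneg _ _)
    (fun f g => tendsto_nhds_unique (h _) (by simpa using (h f).mul (h g)))
    fun f g => le_of_tendsto_of_tendsto' (h _) ((h f).add (h g)) fun i => map_add_le_add (v i) f g

lemma exists_seminorm_lim {ι : Type*} (U : Ultrafilter ι) (v : ι → MulRingSeminorm B)
    (h : ∀ f, ∃ C : ℝ, ∀ᶠ i in U, v i f ≤ C) :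
    ∃ w : MulRingSeminorm B, ∀ f, Tendsto (fun i => v i f) U (𝓝 (w f)) := by
  have (f : B) : ∃ l : ℝ, Tendsto (fun i => v i f) U (𝓝 l) := by
    obtain ⟨C, hC⟩ := h f
    obtain ⟨l, -, hl⟩ := (isCompact_Icc (a := (0 : ℝ)) (b := C)).ultrafilter_le_nhds
      (U.map fun i => v i f) (by
        rw [le_principal_iff]
        exact hC.mono fun i hi => ⟨apply_nonneg _ _, hi⟩)
    exact ⟨l, hl⟩
  choose l hl using this
  exact ⟨seminormLim U v l hl, hl⟩

/-- If y exceeded m, the powers of their ratio would outgrow every linear function of n. This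
absorbs the n + 1 terms of a binomial expansion. -/
lemma le_of_pow_le_mul_pow {y m C : ℝ} (hm : 0 ≤ m)
    (h : ∀ n : ℕ, y ^ n ≤ (C * n + C) * m ^ n) : y ≤ m := by
  by_contra! hlt
  have hy : 0 < y := hm.trans_lt hlt
  obtain ⟨q, hq1, hq⟩ : ∃ q, 1 < q ∧ m * q ≤ y := by
    rcases hm.eq_or_lt with rfl | hm
    · exact ⟨2, by norm_num, by simpa using hy.le⟩
    · exact ⟨y / m, (one_lt_div hm).2 hlt, by field_simp; rfl⟩
  have hm' : 0 < m ∨ m = 0 := by rcases hm.eq_or_lt with h | h <;> simp [h]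
  have h1 : ∀ n : ℕ, 1 ≤ n → q ^ n ≤ C * n + C := by
    intro n hn
    rcases hm' with hm' | hm'
    · have : (m * q) ^ n ≤ (C * n + C) * m ^ n :=
        (pow_le_pow_left₀ (by positivity) hq n).trans (h n)
      rw [mul_pow, mul_comm] at this
      exact le_of_mul_le_mul_right this (by positivity)
    · have := h n
      rw [hm', zero_pow (by omega), mul_zero] at this
      exact absurd this (not_le.2 (by positivity))
  have h2 := tendsto_pow_const_div_const_pow_of_one_lt 1 hq1
  have h3 := tendsto_pow_const_div_const_pow_of_one_lt 0 hq1
  have h4 := (h2.const_mul C).add (h3.const_mul C)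
  simp only [mul_zero, add_zero, pow_one, pow_zero] at h4
  have h5 := h4.eventually (gt_mem_nhds (zero_lt_one' ℝ))
  obtain ⟨n, hn1, hn⟩ := (h5.and (eventually_ge_atTop 1)).exists
  have h6 : 0 < q ^ n := by positivity
  have := h1 n hn
  have h7 : C * ((n : ℝ) / q ^ n) + C * (1 / q ^ n) = (C * n + C) / q ^ n := by ring
  rw [h7, div_lt_one h6] at hn1
  linarith

lemma pow_add_le_sum (v : MulRingSeminorm B) (f g : B) (n : ℕ) :
    v (f + g) ^ n ≤ ∑ k ∈ Finset.range (n + 1), v f ^ k * v g ^ (n - k) * v (n.choose k : B) := by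
  rw [← map_pow, add_pow]
  refine (Finset.le_sum_of_subadditive v (map_zero v).le (map_add_le_add v) _ _).trans_eq
    (Finset.sum_congr rfl fun k _ => by simp)

/-- Binomial coefficients have value at most 1, so |f + g|^n ≤ (n + 1) max(|f|, |g|)^n, and the
factor n + 1 disappears in the power trick. -/
lemma isNonarchimedean_of_natCast_le_one {v : MulRingSeminorm B} (h : ∀ n : ℕ, v n ≤ 1) :
    IsNonarchimedean v := by
  intro f g
  refine le_of_pow_le_mul_pow (C := 1) (le_max_of_le_left (apply_nonneg v f)) fun n => ?_
  refine (pow_add_le_sum v f g n).trans ?_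
  have : ∀ k ∈ Finset.range (n + 1), v f ^ k * v g ^ (n - k) * v (n.choose k : B) ≤
      max (v f) (v g) ^ n := by
    intro k hk
    have hk' : k + (n - k) = n := by have := Finset.mem_range.1 hk; omega
    have hf := apply_nonneg v f
    have hg := apply_nonneg v g
    calc _ ≤ max (v f) (v g) ^ k * max (v f) (v g) ^ (n - k) * 1 := by
          gcongr
          exacts [le_max_left _ _, le_max_right _ _, h _]
      _ = _ := by rw [mul_one, ← pow_add, hk']
  refine (Finset.sum_le_sum this).trans_eq ?_
  simp

end Seminorms

/-! ### Gauss norms and the enlargement of a point to a disc. -/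

section Gauss

variable {R : Type*} [CommRing R]

lemma gaussNorm_le_iff (v : MulRingSeminorm R) {r b : ℝ} (hr : 0 ≤ r) (f : R[X]) :
    f.gaussNorm v r ≤ b ↔ ∀ i, v (f.coeff i) * r ^ i ≤ b := by
  refine ⟨fun h i => (le_gaussNorm v f hr i).trans h, fun h => ?_⟩
  obtain ⟨i, hi⟩ := exists_eq_gaussNorm v r f
  exact hi ▸ h i

lemma gaussNorm_mul_of_isNonarchimedean {v : MulRingSeminorm R} (hna : IsNonarchimedean v) {r : ℝ}
    (hr : 0 ≤ r) (p q : R[X]) :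
    (p * q).gaussNorm v r = p.gaussNorm v r * q.gaussNorm v r := by
  refine le_antisymm (gaussNorm_mul_le v hna p q hr) ?_
  rcases hr.eq_or_lt with rfl | hr0
  · simp [gaussNorm_zero_right]
  obtain ⟨i, hi, hlt_p⟩ := p.exists_min_eq_gaussNorm v hr
  obtain ⟨j, hj, hlt_q⟩ := q.exists_min_eq_gaussNorm v hr
  have hp0 := gaussNorm_nonneg v p hr
  have hq0 := gaussNorm_nonneg v q hr
  rcases hp0.eq_or_lt with h | hp
  · rw [← h, zero_mul]; exact gaussNorm_nonneg v _ hr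
  rcases hq0.eq_or_lt with h | hq
  · rw [← h, mul_zero]; exact gaussNorm_nonneg v _ hr
  refine le_trans (le_of_eq ?_) ((p * q).le_gaussNorm v hr (i + j))
  -- With i and j the least indices attaining the two norms, the product of the i-th and j-th
  -- coefficients strictly dominates the coefficient of degree i + j: a smaller first index
  -- contradicts the choice of i, a larger one the choice of j.
  have key : ∀ x ∈ Finset.range (i + j + 1), x ≠ i →
      v (p.coeff x * q.coeff (i + j - x)) < v (p.coeff i * q.coeff (i + j - i)) := by
    intro x hx hne
    rw [Finset.mem_range] at hx
    refine lt_of_mul_lt_mul_right ?_ (pow_nonneg hr (i + j))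
    have e1 : v (p.coeff x * q.coeff (i + j - x)) * r ^ (i + j) =
        (v (p.coeff x) * r ^ x) * (v (q.coeff (i + j - x)) * r ^ (i + j - x)) := by
      have : r ^ (i + j) = r ^ x * r ^ (i + j - x) := by rw [← pow_add]; congr 1; omega
      rw [map_mul, this]; ring
    have e2 : v (p.coeff i * q.coeff (i + j - i)) * r ^ (i + j) =
        p.gaussNorm v r * q.gaussNorm v r := by
      rw [hi, hj, map_mul, Nat.add_sub_cancel_left, pow_add]; ring
    rw [e1, e2]
    rcases lt_or_gt_of_ne hne with h | h
    · refine (mul_le_mul_of_nonneg_left (q.le_gaussNorm v hr _) (by positivity)).trans_lt ?_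
      exact mul_lt_mul_of_pos_right (hlt_p x h) hq
    · exact mul_lt_mul' (p.le_gaussNorm v hr x) (hlt_q _ (by omega)) (by positivity) hp
  rw [coeff_mul, Finset.Nat.sum_antidiagonal_eq_sum_range_succ_mk,
    IsNonarchimedean.apply_sum_eq_of_lt hna (fun a => (map_neg_eq_map v a).symm) (k := i) (by simp) key,
    map_mul,
    Nat.add_sub_cancel_left, hi, hj, pow_add]
  ring

/-- The Gauss seminorm of radius `r` over a nonarchimedean multiplicative seminorm. -/
def gaussSeminorm (v : MulRingSeminorm R) (hna : IsNonarchimedean v) (r : ℝ) (hr : 0 ≤ r) :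
    MulRingSeminorm R[X] :=
  seminormOf (gaussNorm v r) (by simp) (by rw [← C_1, gaussNorm_C]; simp)
    (fun f => gaussNorm_nonneg v f hr) (gaussNorm_mul_of_isNonarchimedean hna hr)
    fun f g => (isNonarchimedean_gaussNorm v hna hr f g).trans
      (max_le_add_of_nonneg (gaussNorm_nonneg v f hr) (gaussNorm_nonneg v g hr))

lemma gaussNorm_taylor_le {v : MulRingSeminorm R} (hna : IsNonarchimedean v) {r : ℝ} (hr : 0 ≤ r)
    {s : R} (hs : v s ≤ r) (f : R[X]) : (taylor s f).gaussNorm v r ≤ f.gaussNorm v r := by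
  have hG := isNonarchimedean_gaussNorm v hna hr
  rw [taylor_apply, comp_eq_sum_left, Polynomial.sum_def]
  rcases f.support.eq_empty_or_nonempty with h | h
  · rw [h]; simpa using gaussNorm_nonneg v f hr
  obtain ⟨i, -, hi⟩ := IsNonarchimedean.finset_image_add_of_nonempty hG
    (fun e => C (f.coeff e) * (X + C s) ^ e) h
  refine hi.trans ?_
  have h1 : gaussNorm v r (X + C s) ≤ r := by
    refine (hG _ _).trans (max_le ?_ ?_)
    · rw [← monomial_one_one_eq_X, gaussNorm_monomial]; simp
    · rw [gaussNorm_C]; exact hs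
  have h2 := map_pow (gaussSeminorm v hna r hr) (X + C s) i
  change gaussNorm v r _ = gaussNorm v r _ ^ i at h2
  rw [gaussNorm_mul_of_isNonarchimedean hna hr, gaussNorm_C, h2]
  refine le_trans ?_ (le_gaussNorm v f hr i)
  gcongr
  exact gaussNorm_nonneg v _ hr

/-- A disc of radius r about 0 is preserved by translation by s when |s| ≤ r; the reverse inequality
comes from translating by -s. -/
lemma gaussNorm_taylor {v : MulRingSeminorm R} (hna : IsNonarchimedean v) {r : ℝ} (hr : 0 ≤ r)
    {s : R} (hs : v s ≤ r) (f : R[X]) : (taylor s f).gaussNorm v r = f.gaussNorm v r := by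
  refine le_antisymm (gaussNorm_taylor_le hna hr hs f) ?_
  conv_lhs => rw [show f = taylor (-s) (taylor s f) by rw [taylor_taylor]; simp]
  exact gaussNorm_taylor_le hna hr (by rwa [map_neg_eq_map]) _

/-- The translation `f ↦ f(T + U)`. -/
def translation (R : Type*) [CommRing R] : R[X] →+* R[X][X] :=
  (taylorAlgHom (X : R[X])).toRingHom.comp (mapRingHom C)

lemma translation_apply (f : R[X]) : translation R f = taylor X (f.map C) := rfl

/-- The seminorm `f ↦ max_k |f^{[k]}| r^k`, where `f^{[k]}` are the Hasse derivatives. -/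
def thicken (v : MulRingSeminorm R[X]) (hna : IsNonarchimedean v) (r : ℝ) (hr : 0 ≤ r) :
    MulRingSeminorm R[X] :=
  seminormComp (gaussSeminorm v hna r hr) (translation R)

lemma thicken_apply (v : MulRingSeminorm R[X]) (hna : IsNonarchimedean v) (r : ℝ) (hr : 0 ≤ r)
    (f : R[X]) : thicken v hna r hr f = (translation R f).gaussNorm v r := rfl

lemma translation_coeff_zero (f : R[X]) : (translation R f).coeff 0 = f := by
  rw [translation_apply, taylor_coeff_zero, eval_map, eval₂_C_X]

lemma translation_coeff_natDegree (f : R[X]) :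
    (translation R f).coeff f.natDegree = C f.leadingCoeff := by
  have h : (f.map (C : R →+* R[X])).natDegree = f.natDegree :=
    natDegree_map_eq_of_injective C_injective f
  rw [translation_apply, ← h, coeff_taylor_natDegree, leadingCoeff_map_of_injective C_injective]

lemma thicken_zero (v : MulRingSeminorm R[X]) (hna : IsNonarchimedean v) (f : R[X]) :
    thicken v hna 0 le_rfl f = v f := by
  rw [thicken_apply, gaussNorm_zero_right, translation_coeff_zero]

/-- The top coefficient of f(T + U) in U is constant. Hence thickening by r > 0 destroys the kernel
over the central fibre, where nonzero constants have value 1. -/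
lemma le_thicken (v : MulRingSeminorm R[X]) (hna : IsNonarchimedean v) (r : ℝ) (hr : 0 ≤ r)
    (f : R[X]) : v (C f.leadingCoeff) * r ^ f.natDegree ≤ thicken v hna r hr f := by
  rw [← translation_coeff_natDegree]
  exact le_gaussNorm v _ hr _

@[simp] lemma thicken_C (v : MulRingSeminorm R[X]) (hna : IsNonarchimedean v) (r : ℝ) (hr : 0 ≤ r)
    (a : R) : thicken v hna r hr (C a) = v (C a) := by
  rw [thicken_apply, translation_apply, map_C, taylor_C, gaussNorm_C]

lemma thicken_X_sub_C (v : MulRingSeminorm R[X]) (hna : IsNonarchimedean v) (r : ℝ) (hr : 0 ≤ r)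
    (a : R) : thicken v hna r hr (X - C a) = max (v (X - C a)) r := by
  have h : translation R (X - C a) = X + C (X - C a) := by
    simp [translation_apply, taylor_C, taylor_X, add_sub_assoc]
  rw [thicken_apply, h]
  apply le_antisymm
  · refine (isNonarchimedean_gaussNorm v hna hr _ _).trans ?_
    rw [gaussNorm_C, ← monomial_one_one_eq_X, gaussNorm_monomial, max_comm]
    simp
  · refine max_le ?_ ?_
    · have := le_gaussNorm v (X + C (X - C a)) hr 0
      rwa [coeff_add, coeff_X_zero, coeff_C_zero, zero_add, pow_zero, mul_one] at this
    · have := le_gaussNorm v (X + C (X - C a)) hr 1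
      rwa [coeff_add, coeff_X_one, coeff_C_of_ne_zero one_ne_zero, add_zero, map_one, one_mul,
        pow_one] at this

/-- Once r ≥ |T| the disc about the point contains the origin and can be recentred there: T itself
is an admissible translation of the variable U. -/
lemma thicken_eq_gaussNorm (v : MulRingSeminorm R[X]) (hna : IsNonarchimedean v) {r : ℝ}
    (hr : 0 ≤ r) (hX : v X ≤ r) (f : R[X]) :
    thicken v hna r hr f = f.gaussNorm (seminormComp v C) r := by
  rw [thicken_apply, translation_apply, gaussNorm_taylor hna hr hX]
  apply le_antisymm
  · refine (gaussNorm_le_iff v hr _).2 fun i => ?_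
    rw [coeff_map]
    exact le_gaussNorm (seminormComp v C) f hr i
  · refine (gaussNorm_le_iff _ hr _).2 fun i => ?_
    have := le_gaussNorm v (f.map C) hr i
    rwa [coeff_map] at this

/-- This allows thickening to be computed over ℂ, where polynomials split. -/
lemma thicken_map {S : Type*} [CommRing S] (φ : R →+* S) (v : MulRingSeminorm S[X])
    (w : MulRingSeminorm R[X]) (h : ∀ f, w f = v (f.map φ)) (hv : IsNonarchimedean v)
    (hw : IsNonarchimedean w) (r : ℝ) (hr : 0 ≤ r) (f : R[X]) :
    thicken w hw r hr f = thicken v hv r hr (f.map φ) := by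
  have e : translation S (f.map φ) = (translation R f).map (mapRingHom φ) := by
    rw [translation_apply, translation_apply, map_taylor, Polynomial.map_map, Polynomial.map_map]
    simp only [coe_mapRingHom, map_X]
    congr 2
    ext a : 1
    simp
  rw [thicken_apply, thicken_apply, e]
  apply le_antisymm
  · refine (gaussNorm_le_iff _ hr _).2 fun i => ?_
    have := le_gaussNorm v ((translation R f).map (mapRingHom φ)) hr i
    rwa [coeff_map, coe_mapRingHom, ← h] at this
  · refine (gaussNorm_le_iff _ hr _).2 fun i => ?_
    rw [coeff_map, coe_mapRingHom, ← h]
    exact le_gaussNorm w _ hr i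

lemma tendsto_gaussNorm {S F : Type*} [Semiring S] [FunLike F S ℝ] {ι : Type*} {l : Filter ι}
    {v : ι → F} {r : ι → ℝ} {w : F} {s : ℝ} (f : S[X])
    (hv : ∀ i, Tendsto (fun j => v j (f.coeff i)) l (𝓝 (w (f.coeff i))))
    (hr : Tendsto r l (𝓝 s)) :
    Tendsto (fun j => f.gaussNorm (v j) (r j)) l (𝓝 (f.gaussNorm w s)) := by
  unfold Polynomial.gaussNorm
  split_ifs with h
  · exact Filter.Tendsto.finset_sup'_nhds_apply h fun i _ => (hv i).mul (hr.pow i)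
  · exact tendsto_const_nhds

end Gauss

/-! ### Classification of archimedean multiplicative seminorms. -/

section Archimedean

/-- Finite dimensionality bounds the map, applying the bound to powers improves the constant to 1,
and applying the result to inverses gives equality. -/
lemma norm_algEquiv_symm_complex {F : Type*} [NormedField F] [NormedAlgebra ℝ F]
    (e : F ≃ₐ[ℝ] ℂ) (z : ℂ) : ‖e.symm z‖ = ‖z‖ := by
  obtain ⟨M, hM0, hM⟩ := (LinearMap.toContinuousLinearMap e.symm.toLinearMap).bound
  have key : ∀ z : ℂ, ‖e.symm z‖ ≤ ‖z‖ := fun z =>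
    le_of_pow_le_mul_pow (C := M) (norm_nonneg z) fun n => by
      have h := hM (z ^ n)
      simp only [LinearMap.coe_toContinuousLinearMap', AlgEquiv.toLinearMap_apply, map_pow,
        norm_pow] at h
      refine h.trans ?_
      gcongr
      nlinarith [(n.cast_nonneg : (0 : ℝ) ≤ n)]
  rcases eq_or_ne z 0 with rfl | hz
  · simp
  refine le_antisymm (key z) ?_
  have h := key z⁻¹
  have hz' : 0 < ‖z‖ := norm_pos_iff.2 hz
  have hz2 : 0 < ‖e.symm z‖ := norm_pos_iff.2 (by simpa using hz)
  rw [map_inv₀, norm_inv, norm_inv] at h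
  exact (inv_le_inv₀ hz2 hz').1 h

/-- A field with an absolute value extending the usual one on `ℚ` embeds into `ℂ`. -/
lemma exists_complex_embedding_of_rat {L : Type*} [Field L] (w : AbsoluteValue L ℝ)
    [CharZero L] (hw : ∀ q : ℚ, w q = |(q : ℝ)|) :
    ∃ ψ : L →+* ℂ, ∀ x, ‖ψ x‖ = w x := by
  let F := UniformSpace.Completion (WithAbs w)
  let ι : L →+* F := UniformSpace.Completion.coeRingHom.comp (WithAbs.equiv w).symm.toRingHom
  have hι : ∀ x, ‖ι x‖ = w x := fun x => by
    change ‖((WithAbs.toAbs w x : WithAbs w) : F)‖ = w x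
    rw [UniformSpace.Completion.norm_coe]
    rfl
  let j : ℚ →+* F := ι.comp (algebraMap ℚ L)
  have hj : ∀ q : ℚ, ‖j q‖ = |(q : ℝ)| := fun q => by
    rw [← hw]
    exact hι _
  have hjc : UniformContinuous j := by
    refine (AddMonoidHomClass.isometry_of_norm j fun q => ?_).uniformContinuous
    rw [hj]; rfl
  let ui : IsUniformInducing (Rat.castHom ℝ) := Rat.isUniformEmbedding_coe_real.isUniformInducing
  let dr : DenseRange (Rat.castHom ℝ) := Rat.isDenseEmbedding_coe_real.dense
  let ρ : ℝ →+* F := IsDenseInducing.extendRingHom ui dr hjc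
  have hρc : Continuous ρ := (uniformContinuous_uniformly_extend ui dr hjc).continuous
  have hρj : ∀ q : ℚ, ρ q = j q := fun q =>
    IsDenseInducing.extend_eq (ui.isDenseInducing dr) hjc.continuous q
  have hρ : ∀ r : ℝ, ‖ρ r‖ = |r| := fun r => by
    refine DenseRange.induction_on dr r (isClosed_eq hρc.norm continuous_abs) fun q => ?_
    exact (congrArg norm (hρj q)).trans (hj q)
  let _ : NormedAlgebra ℝ F :=
    { ρ.toAlgebra with
      norm_smul_le := fun r x => by
        change ‖ρ r * x‖ ≤ _
        rw [norm_mul, hρ]; rfl }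
  rcases NormedAlgebra.Real.nonempty_algEquiv_or F with ⟨⟨e⟩⟩ | ⟨⟨e⟩⟩
  · refine ⟨(Complex.ofRealHom.comp e.toRingEquiv.toRingHom).comp ι, fun x => ?_⟩
    rw [← hι x]
    change ‖((e (ι x) : ℝ) : ℂ)‖ = _
    rw [Complex.norm_real]
    conv_rhs => rw [← e.symm_apply_apply (ι x), ← mul_one (e (ι x)), ← smul_eq_mul, map_smul,
      map_one]
    rw [norm_smul, norm_one, mul_one]
  · refine ⟨e.toRingEquiv.toRingHom.comp ι, fun x => ?_⟩
    rw [← hι x]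
    change ‖e (ι x)‖ = _
    rw [← norm_algEquiv_symm_complex e, e.symm_apply_apply]

/-- In positive characteristic the integers form a finite set of residues, so the powers of n would
have bounded values. -/
lemma charZero_of_one_lt {L : Type*} [Field L] (v : MulRingSeminorm L) {n : ℕ} (hn : 1 < v n) :
    CharZero L := by
  obtain ⟨p, hp⟩ := CharP.exists L
  rcases eq_or_ne p 0 with rfl | hp0
  · exact CharP.charP_to_charZero L
  exfalso
  have hle : ∀ m : ℕ, v m ≤ m := fun m => by
    induction m with
    | zero => simp
    | succ m ih =>
      push_cast
      refine (map_add_le_add v _ _).trans ?_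
      rw [map_one]; linarith
  obtain ⟨k, hk⟩ := pow_unbounded_of_one_lt (p : ℝ) hn
  rw [← map_pow, ← Nat.cast_pow, CharP.cast_eq_mod L p] at hk
  have h1 := hle (n ^ k % p)
  have h2 : ((n ^ k % p : ℕ) : ℝ) ≤ p := by
    exact_mod_cast (Nat.mod_lt _ (Nat.pos_of_ne_zero hp0)).le
  linarith

/-- The classification of archimedean absolute values on fields. -/
lemma exists_complex_embedding {L : Type*} [Field L] (v : MulRingSeminorm L)
    (hv : ∃ n : ℕ, 1 < v n) :
    ∃ (ψ : L →+* ℂ) (ε : ℝ), 0 < ε ∧ ε ≤ 1 ∧ ∀ x, v x = ‖ψ x‖ ^ ε := by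
  obtain ⟨n₀, hn₀⟩ := hv
  have : CharZero L := charZero_of_one_lt v hn₀
  have hv0 : ∀ x, v x = 0 → x = 0 := fun x hx => by
    by_contra h
    have : v x * v x⁻¹ = 1 := by rw [← map_mul, mul_inv_cancel₀ h, map_one]
    rw [hx, zero_mul] at this
    exact zero_ne_one this
  let f : AbsoluteValue ℚ ℝ :=
    { toFun := fun q => v q
      map_mul' := by simp
      nonneg' := fun q => apply_nonneg v _
      eq_zero' := fun q => ⟨fun h => by exact_mod_cast hv0 _ h, by rintro rfl; simp⟩
      add_le' := fun a b => by simpa using map_add_le_add v (a : L) b }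
  have hf : ∀ q, f q = v q := fun _ => rfl
  have hfb : ¬ ∀ n : ℕ, f n ≤ 1 := by
    push Not
    exact ⟨n₀, by simpa [hf] using hn₀⟩
  -- Ostrowski: the restriction to ℚ is a power of the usual absolute value.
  obtain ⟨c, hc0, hc⟩ := AbsoluteValue.isEquiv_iff_exists_rpow_eq.1
    (Rat.AbsoluteValue.equiv_real_of_unbounded hfb)
  have hcq : ∀ q : ℚ, v q ^ c = |(q : ℝ)| := fun q => by
    have := congrFun hc q
    simpa [hf] using this
  have hcn : ∀ n : ℕ, v n = (n : ℝ) ^ c⁻¹ := fun n => by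
    have := hcq n
    rw [Rat.cast_natCast, Rat.cast_natCast, Nat.abs_cast] at this
    rw [← this, Real.rpow_rpow_inv (apply_nonneg v _) hc0.ne']
  have hε : c⁻¹ ≤ 1 := by
    have h2 : v (2 : ℕ) ≤ 2 := by
      have := map_add_le_add v (1 : L) 1
      rw [map_one, one_add_one_eq_two, one_add_one_eq_two] at this
      simpa using this
    rw [hcn] at h2
    by_contra! h
    have := Real.rpow_lt_rpow_of_exponent_lt (x := 2) (by norm_num) h
    rw [Real.rpow_one] at this
    push_cast at h2
    linarith
  have hε0 : 0 < c⁻¹ := inv_pos.2 hc0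
  -- As c ≥ 1, the triangle inequality for v^c is not formal. Since v of a binomial coefficient is
  -- its power with exponent 1/c, each term of the expansion of (x + y)^n is the corresponding term
  -- of S^n raised to 1/c, hence at most (S^n)^(1/c).
  have hadd : ∀ x y : L, v (x + y) ^ c ≤ v x ^ c + v y ^ c := fun x y => by
    have hx := Real.rpow_nonneg (apply_nonneg v x) c
    have hy := Real.rpow_nonneg (apply_nonneg v y) c
    set S := v x ^ c + v y ^ c with hS
    suffices h : v (x + y) ≤ S ^ c⁻¹ by
      have := Real.rpow_le_rpow (apply_nonneg v _) h hc0.le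
      rwa [Real.rpow_inv_rpow (by positivity) hc0.ne'] at this
    refine le_of_pow_le_mul_pow (C := 1) (by positivity) fun n => ?_
    refine (pow_add_le_sum v x y n).trans ?_
    have key : ∀ k ∈ Finset.range (n + 1), v x ^ k * v y ^ (n - k) * v (n.choose k : L) ≤
        (S ^ c⁻¹) ^ n := by
      intro k hk
      have hxk : v x ^ k = ((v x ^ c) ^ k) ^ c⁻¹ := by
        rw [← Real.rpow_natCast (v x ^ c), ← Real.rpow_mul (apply_nonneg v x),
          ← Real.rpow_mul (apply_nonneg v x), mul_right_comm, mul_inv_cancel₀ hc0.ne', one_mul,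
          Real.rpow_natCast]
      have hyk : v y ^ (n - k) = ((v y ^ c) ^ (n - k)) ^ c⁻¹ := by
        rw [← Real.rpow_natCast (v y ^ c), ← Real.rpow_mul (apply_nonneg v y),
          ← Real.rpow_mul (apply_nonneg v y), mul_right_comm, mul_inv_cancel₀ hc0.ne', one_mul,
          Real.rpow_natCast]
      have hSn : (S ^ c⁻¹) ^ n = (S ^ n) ^ c⁻¹ := by
        rw [← Real.rpow_natCast, ← Real.rpow_natCast, ← Real.rpow_mul (by positivity),
          ← Real.rpow_mul (by positivity), mul_comm]
      rw [hxk, hyk, hcn, hSn, ← Real.mul_rpow (by positivity) (by positivity),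
        ← Real.mul_rpow (by positivity) (by positivity)]
      refine Real.rpow_le_rpow (by positivity) ?_ hε0.le
      rw [hS, add_pow]
      exact Finset.single_le_sum
        (f := fun k => (v x ^ c) ^ k * (v y ^ c) ^ (n - k) * (n.choose k : ℝ))
        (fun i _ => by positivity) hk
    refine (Finset.sum_le_sum key).trans_eq ?_
    simp
  let w : AbsoluteValue L ℝ :=
    { toFun := fun x => v x ^ c
      map_mul' := fun x y => by
        rw [map_mul, Real.mul_rpow (apply_nonneg v x) (apply_nonneg v y)]
      nonneg' := fun x => Real.rpow_nonneg (apply_nonneg v x) c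
      eq_zero' := fun x => by
        rw [Real.rpow_eq_zero (apply_nonneg v x) hc0.ne']
        exact ⟨hv0 x, by rintro rfl; simp⟩
      add_le' := hadd }
  obtain ⟨ψ, hψ⟩ := exists_complex_embedding_of_rat w hcq
  refine ⟨ψ, c⁻¹, hε0, hε, fun x => ?_⟩
  rw [hψ]
  exact (Real.rpow_rpow_inv (apply_nonneg v x) hc0.ne').symm

/-- A multiplicative norm on a domain extends to its field of fractions. -/
lemma exists_extension_fractionRing {D : Type*} [CommRing D] [IsDomain D] (v : MulRingSeminorm D)
    (hv : ∀ x, v x = 0 → x = 0) :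
    ∃ w : MulRingSeminorm (FractionRing D), ∀ x, w (algebraMap D _ x) = v x := by
  let S := nonZeroDivisors D
  let φ := IsLocalization.toLocalizationMap S (FractionRing D)
  have hu : ∀ s : S, IsUnit ((v : D →* ℝ) s) := fun s =>
    isUnit_iff_ne_zero.2 fun h => nonZeroDivisors.ne_zero s.2 (hv _ h)
  let w : FractionRing D →* ℝ := φ.lift hu
  have hw : ∀ x, w (algebraMap D _ x) = v x := fun x => φ.lift_eq hu x
  have hrep : ∀ x : FractionRing D, ∃ (a s : D), s ≠ 0 ∧
      x * algebraMap D _ s = algebraMap D _ a := fun x => by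
    obtain ⟨⟨a, s⟩, h⟩ := IsLocalization.surj S x
    exact ⟨a, s, nonZeroDivisors.ne_zero s.2, h⟩
  have hpos : ∀ s : D, s ≠ 0 → 0 < v s := fun s hs =>
    lt_of_le_of_ne (apply_nonneg v s) fun h => hs (hv s h.symm)
  have hnn : ∀ x, 0 ≤ w x := fun x => by
    obtain ⟨a, s, hs, h⟩ := hrep x
    have := congrArg w h
    rw [map_mul, hw, hw] at this
    by_contra! hx
    nlinarith [apply_nonneg v a, hpos s hs]
  refine ⟨seminormOf w ?_ (map_one w) hnn (map_mul w) fun x y => ?_, hw⟩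
  · rw [← map_zero (algebraMap D (FractionRing D)), hw, map_zero]
  · obtain ⟨a, s, hs, h⟩ := hrep x
    obtain ⟨b, t, ht, h'⟩ := hrep y
    have e : (x + y) * algebraMap D _ (s * t) = algebraMap D _ (a * t + b * s) := by
      rw [map_mul, map_add, map_mul, map_mul, ← h, ← h']; ring
    have e1 := congrArg w e
    have e2 := congrArg w h
    have e3 := congrArg w h'
    simp only [map_mul w, hw] at e1 e2 e3
    have h4 := map_add_le_add v (a * t) (b * s)
    rw [map_mul v, map_mul v, ← e1, ← e2, ← e3, map_mul v] at h4
    have h5 := mul_pos (hpos s hs) (hpos t ht)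
    refine le_of_mul_le_mul_right ?_ h5
    linarith

/-- The classification of archimedean multiplicative seminorms. -/
theorem exists_complex_character {B : Type*} [CommRing B] (v : MulRingSeminorm B)
    (hv : ∃ n : ℕ, 1 < v n) :
    ∃ (φ : B →+* ℂ) (ε : ℝ), 0 < ε ∧ ε ≤ 1 ∧ ∀ x, v x = ‖φ x‖ ^ ε := by
  -- The kernel is prime; the seminorm descends to a norm on the quotient domain and extends to its
  -- field of fractions.
  let I : Ideal B :=
    { carrier := {x | v x = 0}
      zero_mem' := map_zero v
      add_mem' := fun {a b} ha hb => le_antisymm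
        ((map_add_le_add v a b).trans_eq (by rw [ha.out, hb.out, add_zero])) (apply_nonneg v _)
      smul_mem' := fun c x hx => by
        change v (c * x) = 0
        rw [map_mul, hx.out, mul_zero] }
  have hI : ∀ x, x ∈ I ↔ v x = 0 := fun _ => Iff.rfl
  have hprime : I.IsPrime := by
    refine ⟨fun h => ?_, fun {x y} h => ?_⟩
    · have : (1 : B) ∈ I := h ▸ Submodule.mem_top
      rw [hI, map_one] at this
      exact one_ne_zero this
    · rwa [hI, map_mul, mul_eq_zero] at h
  have hsub : ∀ a b, v a ≤ v (a - b) + v b := fun a b => by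
    simpa using map_add_le_add v (a - b) b
  have hwd : ∀ a b, (Submodule.quotientRel I).r a b → v a = v b := fun a b h => by
    rw [Submodule.quotientRel_def, hI] at h
    have h1 := hsub a b
    have h2 := hsub b a
    rw [map_sub_rev] at h2
    linarith
  let u : B ⧸ I → ℝ := Quotient.lift v hwd
  have hu : ∀ x, u (Ideal.Quotient.mk I x) = v x := fun _ => rfl
  have hsurj := Ideal.Quotient.mk_surjective (I := I)
  let w : MulRingSeminorm (B ⧸ I) := seminormOf u
    (by rw [← map_zero (Ideal.Quotient.mk I), hu]; simp)
    (by rw [← map_one (Ideal.Quotient.mk I), hu]; simp)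
    (fun x => by obtain ⟨x, rfl⟩ := hsurj x; exact apply_nonneg v x)
    (fun x y => by
      obtain ⟨x, rfl⟩ := hsurj x
      obtain ⟨y, rfl⟩ := hsurj y
      rw [← map_mul, hu, hu, hu, map_mul])
    (fun x y => by
      obtain ⟨x, rfl⟩ := hsurj x
      obtain ⟨y, rfl⟩ := hsurj y
      rw [← map_add, hu, hu, hu]
      exact map_add_le_add v x y)
  have hw : ∀ x, w (Ideal.Quotient.mk I x) = v x := fun _ => rfl
  obtain ⟨W, hW⟩ := exists_extension_fractionRing w fun x hx => by
    obtain ⟨x, rfl⟩ := hsurj x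
    exact Ideal.Quotient.eq_zero_iff_mem.2 hx
  obtain ⟨n, hn⟩ := hv
  obtain ⟨ψ, ε, h0, h1, h⟩ := exists_complex_embedding W ⟨n, by
    rw [← map_natCast (algebraMap (B ⧸ I) _), hW, ← map_natCast (Ideal.Quotient.mk I), hw]
    exact hn⟩
  refine ⟨(ψ.comp (algebraMap _ _)).comp (Ideal.Quotient.mk I), ε, h0, h1, fun x => ?_⟩
  rw [← hw, ← hW, h]
  rfl

end Archimedean

/-! ### Weights that separate the algebraic numbers. -/

section Separation

lemma tendsto_rpow_zero_of_pos {x : ℝ} (hx : 0 < x) :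
    Tendsto (fun ε : ℝ => x ^ ε) (𝓝[>] 0) (𝓝 1) := by
  have h : ContinuousAt (fun ε : ℝ => x ^ ε) 0 := Real.continuousAt_const_rpow hx.ne'
  rw [ContinuousAt, Real.rpow_zero] at h
  exact h.mono_left nhdsWithin_le_nhds

lemma eventually_forall_abs_rpow_sub_one_le {S : Set ℂ} (hS : S.Finite) {κ : ℝ} (hκ : 0 < κ)
    (α : ℂ) : ∃ ε₀ > (0 : ℝ), ∀ β ∈ S, α ≠ β → ∀ ε : ℝ, 0 < ε → ε < ε₀ → |‖α - β‖ ^ ε - 1| ≤ κ := by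
  have h : ∀ᶠ ε in 𝓝[>] (0 : ℝ), ∀ β ∈ S, α ≠ β → |‖α - β‖ ^ ε - 1| ≤ κ := by
    rw [hS.eventually_all]
    intro β _
    by_cases hαβ : α = β
    · simp [hαβ]
    have := (tendsto_rpow_zero_of_pos (norm_pos_iff.2 (sub_ne_zero.2 hαβ))).eventually
      (Metric.closedBall_mem_nhds 1 hκ)
    filter_upwards [this] with ε hε _
    simpa [Real.dist_eq] using hε
  obtain ⟨ε₀, h0, hε₀⟩ := mem_nhdsGT_iff_exists_Ioo_subset.1 h
  exact ⟨ε₀, h0, fun β hβ hne ε h1 h2 => hε₀ ⟨h1, h2⟩ β hβ hne⟩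

/-- Weights on a countable set of complex numbers, decaying so fast that for small exponents the
points of weight larger than the exponent are at mutual distances whose powers are close to `1`. -/
lemma exists_separating_weights_aux {S : Set ℂ} (hS : S.Countable) :
    ∃ d : ℂ → ℝ, (∀ α, 0 < d α ∧ d α ≤ 1) ∧ (∀ κ > 0, {α ∈ S | κ ≤ d α}.Finite) ∧
      (∀ β ∈ S, ∀ κ > 0, ∃ ε₀ > (0 : ℝ), ∀ α ∈ S, α ≠ β → ∀ ε : ℝ, 0 < ε → ε < ε₀ → ε < d α →
        |‖α - β‖ ^ ε - 1| ≤ κ) ∧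
      ∀ α ∈ S, ∀ β ∈ S, α ≠ β → ∀ ε : ℝ, 0 < ε → ε < d α → ε < d β → 3 / 4 < ‖α - β‖ ^ ε := by
  obtain ⟨e, he⟩ := Set.countable_iff_exists_injOn.1 hS
  have hfin : ∀ N : ℕ, {α ∈ S | e α < N}.Finite := fun N =>
    Set.Finite.of_injOn (f := e) (t := Set.Iio N) (fun α hα => hα.2)
      (he.mono fun α hα => hα.1) (Set.finite_Iio N)
  -- Only the finitely many earlier points constrain the weight of a point. The bound 1/(e α + 5)
  -- tends to 0 along the enumeration and is at most 1/5, which keeps powers of distances above 3/4.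
  have hex : ∀ α : ℂ, ∃ d : ℝ, 0 < d ∧ d ≤ 1 / ((e α : ℝ) + 1) ∧
      ∀ β ∈ S, e β < e α → α ≠ β → ∀ ε : ℝ, 0 < ε → ε < d →
        |‖α - β‖ ^ ε - 1| ≤ 1 / ((e α : ℝ) + 5) := fun α => by
    obtain ⟨ε₀, h0, h⟩ := eventually_forall_abs_rpow_sub_one_le (hfin (e α))
      (κ := 1 / ((e α : ℝ) + 5)) (by positivity) α
    refine ⟨min ε₀ (1 / ((e α : ℝ) + 1)), lt_min h0 (by positivity), min_le_right _ _, ?_⟩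
    intro β hβ hlt hne ε h1 h2
    exact h β ⟨hβ, hlt⟩ hne ε h1 (h2.trans_le (min_le_left _ _))
  choose d hd0 hd1 hd using hex
  refine ⟨d, fun α => ⟨hd0 α, (hd1 α).trans ?_⟩, fun κ hκ => ?_, fun β hβ κ hκ => ?_, ?_⟩
  · rw [div_le_one (by positivity)]
    linarith [(e α).cast_nonneg (α := ℝ)]
  · obtain ⟨N, hN⟩ := exists_nat_gt (1 / κ)
    refine (hfin N).subset fun α hα => ⟨hα.1, ?_⟩
    have h1 := hα.2.trans (hd1 α)
    rw [le_div_iff₀ (by positivity)] at h1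
    rw [div_lt_iff₀ hκ] at hN
    have : (e α : ℝ) < N := by nlinarith
    exact_mod_cast this
  · obtain ⟨N, hN⟩ := exists_nat_gt (1 / κ)
    -- Points of index at least N are close enough by their own weight, provided they also come
    -- after β; the finitely many others are handled by ε₀.
    obtain ⟨ε₀, h0, h⟩ := eventually_forall_abs_rpow_sub_one_le (hfin (max N (e β + 1))) hκ β
    refine ⟨ε₀, h0, fun α hα hne ε h1 h2 h3 => ?_⟩
    by_cases hαN : e α < max N (e β + 1)
    · rw [norm_sub_rev]
      exact h α ⟨hα, hαN⟩ hne.symm ε h1 h2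
    · rw [not_lt, max_le_iff] at hαN
      refine (hd α β hβ (by omega) hne ε h1 h3).trans ?_
      rw [div_lt_iff₀ hκ] at hN
      rw [div_le_iff₀ (by positivity)]
      have : (N : ℝ) ≤ e α := by exact_mod_cast hαN.1
      nlinarith
  · have key : ∀ α ∈ S, ∀ β ∈ S, e β < e α → α ≠ β → ∀ ε : ℝ, 0 < ε → ε < d α →
        3 / 4 < ‖α - β‖ ^ ε := by
      intro α _ β hβ hlt hne ε h1 h2
      have h3 := hd α β hβ hlt hne ε h1 h2
      have h4 : 1 / ((e α : ℝ) + 5) ≤ 1 / 5 :=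
        one_div_le_one_div_of_le (by norm_num) (by linarith [(e α).cast_nonneg (α := ℝ)])
      have := (abs_le.1 h3).1
      linarith
    intro α hα β hβ hne ε h1 h2 h3
    rcases lt_trichotomy (e α) (e β) with h | h | h
    · rw [norm_sub_rev]
      exact key β hβ α hα h hne.symm ε h1 h3
    · exact absurd (he hα hβ h) hne
    · exact key α hα β hβ h hne ε h1 h2

/-- The set of complex algebraic numbers. -/
def algebraicNumbers : Set ℂ := {α | IsAlgebraic ℚ α}

lemma conj_mem_algebraicNumbers {α : ℂ} (h : α ∈ algebraicNumbers) :
    starRingEnd ℂ α ∈ algebraicNumbers :=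
  IsAlgebraic.algHom (Complex.conjAe.toAlgHom.restrictScalars ℚ) h

/-- Invariance under conjugation is needed because an archimedean point determines its embedding and
coordinate only up to conjugation. The minimum over a conjugate pair preserves the other properties.
-/
lemma exists_separating_weights :
    ∃ d : ℂ → ℝ, (∀ α, 0 < d α ∧ d α ≤ 1) ∧ (∀ κ > 0, {α ∈ algebraicNumbers | κ ≤ d α}.Finite) ∧
      (∀ β ∈ algebraicNumbers, ∀ κ > 0, ∃ ε₀ > (0 : ℝ), ∀ α ∈ algebraicNumbers, α ≠ β →
        ∀ ε : ℝ, 0 < ε → ε < ε₀ → ε < d α → |‖α - β‖ ^ ε - 1| ≤ κ) ∧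
      (∀ α ∈ algebraicNumbers, ∀ β ∈ algebraicNumbers, α ≠ β → ∀ ε : ℝ, 0 < ε → ε < d α → ε < d β →
        3 / 4 < ‖α - β‖ ^ ε) ∧
      ∀ α, d (starRingEnd ℂ α) = d α := by
  obtain ⟨d, h1, h2, h3, h4⟩ :=
    exists_separating_weights_aux (S := algebraicNumbers) (Algebraic.countable ℚ ℂ)
  refine ⟨fun α => min (d α) (d (starRingEnd ℂ α)), fun α => ⟨lt_min (h1 _).1 (h1 _).1,
    min_le_of_left_le (h1 _).2⟩, fun κ hκ => ?_, fun β hβ κ hκ => ?_, ?_, fun α => ?_⟩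
  · exact (h2 κ hκ).subset fun α hα => ⟨hα.1, hα.2.trans (min_le_left _ _)⟩
  · obtain ⟨ε₀, h0, h⟩ := h3 β hβ κ hκ
    exact ⟨ε₀, h0, fun α hα hne ε e1 e2 e3 =>
      h α hα hne ε e1 e2 (e3.trans_le (min_le_left _ _))⟩
  · intro α hα β hβ hne ε e1 e2 e3
    exact h4 α hα β hβ hne ε e1 (e2.trans_le (min_le_left _ _)) (e3.trans_le (min_le_left _ _))
  · simp [min_comm]

/-- A choice of weights as in `exists_separating_weights`. -/
def weight : ℂ → ℝ := exists_separating_weights.choose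

lemma weight_pos (α : ℂ) : 0 < weight α := (exists_separating_weights.choose_spec.1 α).1

lemma weight_le_one (α : ℂ) : weight α ≤ 1 := (exists_separating_weights.choose_spec.1 α).2

lemma finite_le_weight {κ : ℝ} (hκ : 0 < κ) : {α ∈ algebraicNumbers | κ ≤ weight α}.Finite :=
  exists_separating_weights.choose_spec.2.1 κ hκ

lemma exists_forall_abs_rpow_sub_one_le {β : ℂ} (hβ : β ∈ algebraicNumbers) {κ : ℝ} (hκ : 0 < κ) :
    ∃ ε₀ > (0 : ℝ), ∀ α ∈ algebraicNumbers, α ≠ β → ∀ ε : ℝ, 0 < ε → ε < ε₀ → ε < weight α →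
      |‖α - β‖ ^ ε - 1| ≤ κ :=
  exists_separating_weights.choose_spec.2.2.1 β hβ κ hκ

lemma lt_rpow_of_lt_weight {α β : ℂ} (hα : α ∈ algebraicNumbers) (hβ : β ∈ algebraicNumbers)
    (h : α ≠ β) {ε : ℝ} (h0 : 0 < ε) (h1 : ε < weight α) (h2 : ε < weight β) :
    3 / 4 < ‖α - β‖ ^ ε :=
  exists_separating_weights.choose_spec.2.2.2.1 α hα β hβ h ε h0 h1 h2

lemma weight_conj (α : ℂ) : weight (starRingEnd ℂ α) = weight α :=
  exists_separating_weights.choose_spec.2.2.2.2 α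

end Separation

/-! ### Seminorms on complex polynomials. -/

section Points

variable {B : Type*} [CommRing B]

/-- The seminorm `f ↦ |φ(f)|^ε` attached to a ring homomorphism to the complex numbers. -/
def charSeminorm (φ : B →+* ℂ) (ε : ℝ) (h : 0 < ε ∧ ε ≤ 1) : MulRingSeminorm B :=
  seminormOf (fun f => ‖φ f‖ ^ ε) (by simp [Real.zero_rpow h.1.ne']) (by simp)
    (fun _ => by positivity)
    (fun f g => by rw [map_mul, norm_mul, Real.mul_rpow (norm_nonneg _) (norm_nonneg _)])
    fun f g => by
      rw [map_add]
      exact (Real.rpow_le_rpow (norm_nonneg _) (norm_add_le _ _) h.1.le).trans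
        (Real.rpow_add_le_add_rpow (norm_nonneg _) (norm_nonneg _) h.1.le h.2)

@[simp] lemma charSeminorm_apply (φ : B →+* ℂ) (ε : ℝ) (h : 0 < ε ∧ ε ≤ 1) (f : B) :
    charSeminorm φ ε h f = ‖φ f‖ ^ ε := rfl

/-- The seminorm `f ↦ s ^ ord_α(f)` over the trivially valued complex numbers, with `s` clipped to
the unit interval. -/
def ordSeminorm (α : ℂ) (s : ℝ) : MulRingSeminorm ℂ[X] := by
  classical
  have hs0 : 0 ≤ max 0 (min 1 s) := le_max_left _ _
  have hs1 : max 0 (min 1 s) ≤ 1 := max_le zero_le_one (min_le_left _ _)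
  refine seminormOf (fun f => if f = 0 then 0 else max 0 (min 1 s) ^ f.rootMultiplicity α) (by simp)
    (by simp [rootMultiplicity_eq_zero]) (fun f => ?_) (fun f g => ?_) fun f g => ?_
  · split_ifs <;> positivity
  · by_cases hf : f = 0
    · simp [hf]
    by_cases hg : g = 0
    · simp [hg]
    simp [hf, hg, rootMultiplicity_mul, pow_add]
  · by_cases hf : f = 0
    · simp [hf]
    by_cases hg : g = 0
    · simp [hg]
    by_cases hfg : f + g = 0
    · simp only [hfg, if_true, hf, hg, if_false]; positivity
    simp only [hfg, hf, hg, if_false]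
    have h1 := rootMultiplicity_add α hfg
    have h2 := pow_le_pow_of_le_one hs0 hs1 h1
    rcases min_choice (rootMultiplicity α f) (rootMultiplicity α g) with h | h <;> rw [h] at h2
    · exact h2.trans (le_add_of_nonneg_right (by positivity))
    · exact h2.trans (le_add_of_nonneg_left (by positivity))

lemma ordSeminorm_apply (α : ℂ) {s : ℝ} (h0 : 0 ≤ s) (h1 : s ≤ 1) {f : ℂ[X]} (hf : f ≠ 0) :
    ordSeminorm α s f = s ^ f.rootMultiplicity α := by
  have : max 0 (min 1 s) = s := by rw [min_eq_right h1, max_eq_right h0]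
  conv_rhs => rw [← this]
  exact if_neg hf

/-- Over ℂ every polynomial splits, so multiplicativity reduces convergence to constants and linear
factors. -/
lemma tendsto_of_tendsto_linear {ι : Type*} {l : Filter ι} {v : ι → MulRingSeminorm ℂ[X]}
    {w : MulRingSeminorm ℂ[X]} {f : ℂ[X]}
    (hC : ∀ c : ℂ, c ≠ 0 → Tendsto (fun i => v i (C c)) l (𝓝 (w (C c))))
    (hX : ∀ β ∈ f.roots, Tendsto (fun i => v i (X - C β)) l (𝓝 (w (X - C β)))) :
    Tendsto (fun i => v i f) l (𝓝 (w f)) := by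
  rcases eq_or_ne f 0 with rfl | hf
  · simpa using tendsto_const_nhds
  have h := (IsAlgClosed.splits f).eq_prod_roots
  have key : ∀ s : Multiset ℂ, (∀ β ∈ s, β ∈ f.roots) →
      Tendsto (fun i => v i (s.map fun β => X - C β).prod) l
        (𝓝 (w (s.map fun β => X - C β).prod)) := by
    intro s
    induction s using Multiset.induction with
    | empty => simpa using tendsto_const_nhds
    | cons β s ih =>
      intro hs
      simp only [Multiset.map_cons, Multiset.prod_cons, map_mul]
      exact (hX β (hs β (Multiset.mem_cons_self _ _))).mul
        (ih fun γ hγ => hs γ (Multiset.mem_cons_of_mem hγ))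
  rw [h]
  simp only [map_mul]
  exact (hC _ (leadingCoeff_ne_zero.2 hf)).mul (key _ fun _ h => h)

end Points

/-! ### The deformation in the collar around one algebraic number. -/

section Collar

/-- The radial rescaling `w ↦ w |w|^(1/t - 1)`, extended by zero to `t = 0`. -/
def radialScale (w : ℂ) (t : ℝ) : ℂ := if t = 0 then 0 else w * ((‖w‖ ^ (1 / t - 1) : ℝ) : ℂ)

/-- Replacing ε by tε after this rescaling keeps the value ‖w‖^ε unchanged. -/
lemma norm_radialScale (w : ℂ) {t : ℝ} (ht : 0 < t) (ht1 : t ≤ 1) :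
    ‖radialScale w t‖ = ‖w‖ ^ (1 / t) := by
  have h1 : 1 ≤ 1 / t := (one_le_div ht).2 ht1
  rw [radialScale, if_neg ht.ne', norm_mul, Complex.norm_real, Real.norm_of_nonneg (by positivity)]
  nth_rewrite 1 [← Real.rpow_one ‖w‖]
  rw [← Real.rpow_add_of_nonneg (norm_nonneg _) zero_le_one (by linarith)]
  congr 1; ring

lemma radialScale_one (w : ℂ) : radialScale w 1 = w := by simp [radialScale]

lemma norm_radialScale_le {w : ℂ} (hw : ‖w‖ ≤ 1) {t : ℝ} (ht0 : 0 ≤ t) (ht : t ≤ 1) :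
    ‖radialScale w t‖ ≤ ‖w‖ := by
  rcases ht0.eq_or_lt with rfl | ht0
  · simp [radialScale]
  rw [norm_radialScale w ht0 ht]
  have h1 : 1 ≤ 1 / t := (one_le_div ht0).2 ht
  simpa using Real.rpow_le_rpow_of_exponent_ge' (norm_nonneg w) hw zero_le_one h1

/-- From log ‖w‖ ≤ ‖w‖ - 1 and exp(-x) ≤ 1/x. The bound covers w = 0 and t = 0 and is locally
uniform in w, which gives continuity at t = 0. -/
lemma norm_radialScale_le_div {w : ℂ} (hw : ‖w‖ < 1) {t : ℝ} (ht0 : 0 ≤ t) (ht : t ≤ 1) :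
    ‖radialScale w t‖ ≤ t / (1 - ‖w‖) := by
  have hw' : 0 < 1 - ‖w‖ := by linarith
  rcases ht0.eq_or_lt with rfl | ht0
  · simp [radialScale]
  rw [norm_radialScale w ht0 ht]
  rcases (norm_nonneg w).eq_or_lt with h | h
  · rw [← h, Real.zero_rpow (by positivity)]; positivity
  rw [Real.rpow_def_of_pos h]
  have h1 := Real.log_le_sub_one_of_pos h
  have hx : 0 < (1 - ‖w‖) / t := by positivity
  have h2 : Real.log ‖w‖ * (1 / t) ≤ -((1 - ‖w‖) / t) := by
    rw [mul_one_div, ← neg_div]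
    gcongr
    linarith
  refine (Real.exp_le_exp.2 h2).trans ?_
  rw [Real.exp_neg, show t / (1 - ‖w‖) = ((1 - ‖w‖) / t)⁻¹ by rw [inv_div]]
  refine inv_anti₀ hx ?_
  linarith [Real.add_one_le_exp ((1 - ‖w‖) / t)]

/-- At t = 0 the condition ‖w₀‖ < 1 makes ‖w‖^(1/t) tend to 0. At w₀ = 0 the exponent 1/t - 1 may
vanish, so a direct norm bound replaces continuity of the power. -/
lemma tendsto_radialScale {ι : Type*} {l : Filter ι} {w : ι → ℂ} {t : ι → ℝ} {w₀ : ℂ} {t₀ : ℝ}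
    (hw : Tendsto w l (𝓝 w₀)) (ht : Tendsto t l (𝓝 t₀)) (h01 : ∀ i, 0 ≤ t i ∧ t i ≤ 1)
    (h : 0 < t₀ ∨ t₀ = 0 ∧ ‖w₀‖ < 1) (ht₀ : t₀ ≤ 1) :
    Tendsto (fun i => radialScale (w i) (t i)) l (𝓝 (radialScale w₀ t₀)) := by
  rcases h with h | ⟨rfl, h⟩
  · have hev : ∀ᶠ i in l, radialScale (w i) (t i) =
        w i * ((‖w i‖ ^ (1 / t i - 1) : ℝ) : ℂ) := by
      filter_upwards [ht.eventually (lt_mem_nhds h)] with i hi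
      exact if_neg hi.ne'
    have h1 : 1 ≤ 1 / t₀ := (one_le_div h).2 ht₀
    rw [tendsto_congr' hev, radialScale, if_neg h.ne']
    rcases eq_or_ne w₀ 0 with rfl | hw0
    · rw [zero_mul]
      have hev2 : ∀ᶠ i in l, ‖w i * ((‖w i‖ ^ (1 / t i - 1) : ℝ) : ℂ)‖ ≤ ‖w i‖ := by
        filter_upwards [ht.eventually (lt_mem_nhds h), hw.norm.eventually
          (gt_mem_nhds (show ‖(0 : ℂ)‖ < 1 by simp))] with i hi hi2
        have := norm_radialScale_le hi2.le hi.le (h01 i).2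
        rwa [radialScale, if_neg hi.ne'] at this
      refine squeeze_zero_norm' hev2 ?_
      simpa using hw.norm
    · refine hw.mul ((Complex.continuous_ofReal.tendsto _).comp ?_)
      exact (hw.norm).rpow ((tendsto_const_nhds.div ht h.ne').sub tendsto_const_nhds)
        (Or.inl (norm_ne_zero_iff.2 hw0))
  · rw [show radialScale w₀ 0 = 0 by simp [radialScale]]
    have hev : ∀ᶠ i in l, ‖radialScale (w i) (t i)‖ ≤ t i / (1 - ‖w i‖) := by
      filter_upwards [hw.norm.eventually (gt_mem_nhds h)] with i hi
      exact norm_radialScale_le_div hi (h01 i).1 (h01 i).2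
    refine squeeze_zero_norm' hev ?_
    have := ht.div (tendsto_const_nhds.sub hw.norm) (show (1 : ℝ) - ‖w₀‖ ≠ 0 by linarith)
    rw [zero_div] at this
    exact this

lemma radialScale_conj (w : ℂ) (t : ℝ) :
    radialScale (starRingEnd ℂ w) t = starRingEnd ℂ (radialScale w t) := by
  unfold radialScale
  split_ifs <;> simp

/-- The size of the collar coordinate of `(z, ε)` at the point `α` of weight `d`. -/
def collarSize (d : ℝ) (α z : ℂ) (ε : ℝ) : ℝ := max (‖z - α‖ ^ ε) (2 * ε / d)

/-- The factor by which the collar at `α` changes the exponent. -/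
def collarFactor (d : ℝ) (α z : ℂ) (ε τ : ℝ) : ℝ :=
  max 0 (min 1 (2 - 2 * τ / collarSize d α z ε))

/-- The value of `T - α` on the collar at `α`. -/
def collarHeight (d : ℝ) (α z : ℂ) (ε τ : ℝ) : ℝ := max (‖z - α‖ ^ ε) (max 0 (τ - 2 * ε / d))

lemma collarFactor_mem (d : ℝ) (α z : ℂ) (ε τ : ℝ) :
    0 ≤ collarFactor d α z ε τ ∧ collarFactor d α z ε τ ≤ 1 :=
  ⟨le_max_left _ _, max_le zero_le_one (min_le_left _ _)⟩

/-- The deformation at time `τ` of the point `(z, ε)` in the collar around `α`: the exponent is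
decreased until the trivially valued fibre is reached, where the branch at `α` is pushed away from
its end. -/
def collar (d : ℝ) (α z : ℂ) (ε τ : ℝ) (h : 0 < ε ∧ ε ≤ 1) : MulRingSeminorm ℂ[X] :=
  if ht : collarFactor d α z ε τ = 0 then ordSeminorm α (collarHeight d α z ε τ)
  else charSeminorm (evalRingHom (α + radialScale (z - α) (collarFactor d α z ε τ)))
    (collarFactor d α z ε τ * ε)
    ⟨mul_pos (lt_of_le_of_ne (collarFactor_mem d α z ε τ).1 (Ne.symm ht)) h.1,
      mul_le_one₀ (collarFactor_mem d α z ε τ).2 h.1.le h.2⟩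

variable {d : ℝ} {α z : ℂ} {ε τ : ℝ}

lemma collarSize_pos (hd : 0 < d) (h : 0 < ε) : 0 < collarSize d α z ε :=
  lt_max_of_lt_right (by positivity)

/-- The collar acts trivially where its size is at least 2τ, and reaches the trivially valued fibre
where its size is at most τ. -/
lemma collarFactor_eq_one (hd : 0 < d) (h : 0 < ε) (hτ : 2 * τ ≤ collarSize d α z ε) :
    collarFactor d α z ε τ = 1 := by
  have h1 : 2 * τ / collarSize d α z ε ≤ 1 := (div_le_one (collarSize_pos hd h)).2 hτ
  rw [collarFactor, min_eq_left (by linarith), max_eq_right zero_le_one]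

lemma collarFactor_eq_zero_iff (hd : 0 < d) (h : 0 < ε) :
    collarFactor d α z ε τ = 0 ↔ collarSize d α z ε ≤ τ := by
  have h0 := collarSize_pos (α := α) (z := z) hd h
  rw [collarFactor, max_eq_left_iff, min_le_iff, or_iff_right (by norm_num), sub_nonpos,
    le_div_iff₀ h0]
  constructor <;> intro h <;> linarith

lemma collar_eq_charSeminorm (hd : 0 < d) (h : 0 < ε ∧ ε ≤ 1) (hτ : 2 * τ ≤ collarSize d α z ε) :
    collar d α z ε τ h = charSeminorm (evalRingHom z) ε h := by
  have h1 := collarFactor_eq_one hd h.1 hτ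
  unfold collar
  rw [dif_neg (by rw [h1]; exact one_ne_zero)]
  apply MulRingSeminorm.ext
  intro f
  simp only [charSeminorm_apply]
  rw [h1, radialScale_one, add_sub_cancel, one_mul]

lemma collarHeight_mem (hd : 0 < d) (h : 0 < ε ∧ ε ≤ 1) (hτ : τ ≤ 1)
    (ht : collarFactor d α z ε τ = 0) :
    0 ≤ collarHeight d α z ε τ ∧ collarHeight d α z ε τ ≤ 1 := by
  rw [collarFactor_eq_zero_iff hd h.1, collarSize, max_le_iff] at ht
  refine ⟨le_max_of_le_left (by positivity), max_le (ht.1.trans hτ) (max_le zero_le_one ?_)⟩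
  have : 0 ≤ 2 * ε / d := by have := h.1; positivity
  linarith

lemma collar_C (hd : 0 < d) (h : 0 < ε ∧ ε ≤ 1) (hτ : τ ≤ 1) {c : ℂ} (hc : c ≠ 0) :
    collar d α z ε τ h (C c) = ‖c‖ ^ (collarFactor d α z ε τ * ε) := by
  unfold collar
  split_ifs with ht
  · rw [ordSeminorm_apply α (collarHeight_mem hd h hτ ht).1 (collarHeight_mem hd h hτ ht).2
      (C_ne_zero.2 hc), rootMultiplicity_C, ht]
    simp
  · simp

/-- Rescaling preserves |z - α|^ε. The two cases match because a positive factor means size greater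
than τ, so that τ - 2ε/d does not exceed |z - α|^ε. -/
lemma collar_X_sub_C_self (hd : 0 < d) (h : 0 < ε ∧ ε ≤ 1) (hτ : τ ≤ 1) :
    collar d α z ε τ h (X - C α) = collarHeight d α z ε τ := by
  unfold collar
  split_ifs with ht
  · rw [ordSeminorm_apply α (collarHeight_mem hd h hτ ht).1 (collarHeight_mem hd h hτ ht).2
      (X_sub_C_ne_zero α), rootMultiplicity_X_sub_C_self, pow_one]
  · have h0 : 0 < collarFactor d α z ε τ :=
      lt_of_le_of_ne (collarFactor_mem d α z ε τ).1 (Ne.symm ht)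
    have h1 : max 0 (τ - 2 * ε / d) ≤ ‖z - α‖ ^ ε := by
      refine max_le (by positivity) ?_
      rw [collarFactor_eq_zero_iff hd h.1, not_le, collarSize, lt_max_iff] at ht
      rcases ht with ht | ht
      · have : 0 ≤ 2 * ε / d := by have := h.1; positivity
        linarith
      · exact le_trans (by linarith) (Real.rpow_nonneg (norm_nonneg _) ε)
    rw [collarHeight, max_eq_left h1]
    simp only [charSeminorm_apply, coe_evalRingHom, eval_sub, eval_X, eval_C, add_sub_cancel_left]
    rw [norm_radialScale _ h0 (collarFactor_mem d α z ε τ).2, ← Real.rpow_mul (norm_nonneg _)]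
    congr 1
    field_simp

lemma collar_X_sub_C (hd : 0 < d) (h : 0 < ε ∧ ε ≤ 1) (hτ : τ ≤ 1) {β : ℂ} (hβ : β ≠ α) :
    collar d α z ε τ h (X - C β) =
      ‖α + radialScale (z - α) (collarFactor d α z ε τ) - β‖ ^ (collarFactor d α z ε τ * ε) := by
  unfold collar
  split_ifs with ht
  · rw [ordSeminorm_apply α (collarHeight_mem hd h hτ ht).1 (collarHeight_mem hd h hτ ht).2
      (X_sub_C_ne_zero β), rootMultiplicity_eq_zero, ht]
    · simp
    · simpa [sub_eq_zero] using hβ.symm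
  · simp

/-- Values on constants and linear factors are given by continuous formulas. When the factor tends
to 0, the limit satisfies ‖z₀ - α‖ < 1 because τ₀ < 1, the centre tends to α, and α - β ≠ 0 keeps
the power continuous. -/
lemma tendsto_collar {ι : Type*} {l : Filter ι} {z : ι → ℂ} {ε τ : ι → ℝ} {z₀ : ℂ} {ε₀ τ₀ : ℝ}
    (hz : Tendsto z l (𝓝 z₀)) (hε : Tendsto ε l (𝓝 ε₀)) (hτ : Tendsto τ l (𝓝 τ₀)) (hd : 0 < d)
    (h : ∀ i, 0 < ε i ∧ ε i ≤ 1) (h₀ : 0 < ε₀ ∧ ε₀ ≤ 1) (hτ1 : ∀ i, τ i ≤ 1) (hτ₀ : τ₀ < 1)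
    (f : ℂ[X]) :
    Tendsto (fun i => collar d α (z i) (ε i) (τ i) (h i) f) l
      (𝓝 (collar d α z₀ ε₀ τ₀ h₀ f)) := by
  have hs : Tendsto (fun i => ‖z i - α‖ ^ ε i) l (𝓝 (‖z₀ - α‖ ^ ε₀)) :=
    (hz.sub_const α).norm.rpow hε (Or.inr h₀.1)
  have hq : Tendsto (fun i => 2 * ε i / d) l (𝓝 (2 * ε₀ / d)) := (hε.const_mul 2).div_const d
  have hM : Tendsto (fun i => collarSize d α (z i) (ε i)) l (𝓝 (collarSize d α z₀ ε₀)) := hs.max hq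
  have ht : Tendsto (fun i => collarFactor d α (z i) (ε i) (τ i)) l
      (𝓝 (collarFactor d α z₀ ε₀ τ₀)) :=
    tendsto_const_nhds.max (tendsto_const_nhds.min (tendsto_const_nhds.sub
      ((hτ.const_mul 2).div hM (collarSize_pos hd h₀.1).ne')))
  have hte := ht.mul hε
  have hmem := collarFactor_mem d α z₀ ε₀ τ₀
  apply tendsto_of_tendsto_linear
  · intro c hc
    simp only [collar_C hd (h _) (hτ1 _) hc, collar_C hd h₀ hτ₀.le hc]
    exact tendsto_const_nhds.rpow hte (Or.inl (norm_ne_zero_iff.2 hc))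
  · intro β _
    rcases eq_or_ne β α with rfl | hβ
    · simp only [collar_X_sub_C_self hd (h _) (hτ1 _), collar_X_sub_C_self hd h₀ hτ₀.le]
      exact hs.max (tendsto_const_nhds.max (hτ.sub hq))
    · simp only [collar_X_sub_C hd (h _) (hτ1 _) hβ, collar_X_sub_C hd h₀ hτ₀.le hβ]
      have hcase : 0 < collarFactor d α z₀ ε₀ τ₀ ∨
          collarFactor d α z₀ ε₀ τ₀ = 0 ∧ ‖z₀ - α‖ < 1 := by
        rcases hmem.1.eq_or_lt with h0 | h0
        · refine Or.inr ⟨h0.symm, ?_⟩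
          have := (collarFactor_eq_zero_iff hd h₀.1).1 h0.symm
          have h1 : ‖z₀ - α‖ ^ ε₀ < 1 := ((le_max_left _ _).trans this).trans_lt hτ₀
          by_contra! hge
          exact absurd h1 (not_lt.2 (Real.one_le_rpow hge h₀.1.le))
        · exact Or.inl h0
      have hR := tendsto_radialScale (hz.sub_const α) ht
        (fun i => collarFactor_mem d α (z i) (ε i) (τ i)) hcase hmem.2
      refine ((tendsto_const_nhds.add hR).sub_const β).norm.rpow hte ?_
      rcases hcase with h0 | ⟨h0, -⟩
      · exact Or.inr (mul_pos h0 h₀.1)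
      · left
        rw [h0]
        simpa [radialScale, sub_eq_zero] using hβ.symm

lemma collar_conj (h : 0 < ε ∧ ε ≤ 1) (f : ℂ[X]) :
    collar d (starRingEnd ℂ α) (starRingEnd ℂ z) ε τ h (f.map (starRingEnd ℂ)) =
      collar d α z ε τ h f := by
  have e1 : starRingEnd ℂ z - starRingEnd ℂ α = starRingEnd ℂ (z - α) := (map_sub _ _ _).symm
  have e2 : ‖starRingEnd ℂ z - starRingEnd ℂ α‖ = ‖z - α‖ := by rw [e1, RCLike.norm_conj]
  have e3 : collarFactor d (starRingEnd ℂ α) (starRingEnd ℂ z) ε τ = collarFactor d α z ε τ := by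
    simp only [collarFactor, collarSize, e2]
  have e4 : collarHeight d (starRingEnd ℂ α) (starRingEnd ℂ z) ε τ = collarHeight d α z ε τ := by
    simp only [collarHeight, e2]
  have hinj : Function.Injective (starRingEnd ℂ) := (starRingEnd ℂ).injective
  unfold collar
  by_cases ht : collarFactor d α z ε τ = 0
  · rw [dif_pos ht, dif_pos (e3.trans ht), e4]
    rcases eq_or_ne f 0 with rfl | hf
    · simp
    have hf' : f.map (starRingEnd ℂ) ≠ 0 := (Polynomial.map_ne_zero_iff hinj).2 hf
    change (if _ then _ else _) = (if _ then _ else _)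
    rw [if_neg hf, if_neg hf', ← eq_rootMultiplicity_map hinj]
  · rw [dif_neg ht, dif_neg (by rwa [e3])]
    simp only [charSeminorm_apply, coe_evalRingHom, e3]
    rw [e1, radialScale_conj, ← map_add, eval_map_apply, RCLike.norm_conj]

end Collar

/-! ### Gluing the collars and their limit as ε tends to 0. -/

section Deformation

/-- The point `(z, ε)` lies in the collar around the algebraic number `α`. -/
def InCollar (α z : ℂ) (ε : ℝ) : Prop :=
  α ∈ algebraicNumbers ∧ ‖z - α‖ ^ ε < 1 / 2 ∧ ε < weight α / 4

variable {α β z : ℂ} {ε τ : ℝ}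

lemma two_rpow_le (h0 : 0 ≤ ε) (h1 : ε ≤ 1) : (2 : ℝ) ^ ε ≤ 1 + ε := by
  have := rpow_one_add_le_one_add_mul_self (s := 1) (by norm_num) h0 h1
  rw [one_add_one_eq_two, mul_one] at this
  exact this

/-- Two centres of collars containing z would satisfy |α - β|^ε ≤ 2^ε / 2 ≤ 5/8, against the
separation bound 3/4. -/
lemma InCollar.unique (h0 : 0 < ε) (hα : InCollar α z ε) (hβ : InCollar β z ε) : α = β := by
  by_contra hne
  have h1 := lt_rpow_of_lt_weight hα.1 hβ.1 hne h0
    (by linarith [hα.2.2, weight_pos α]) (by linarith [hβ.2.2, weight_pos β])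
  have hε : ε ≤ 1 / 4 := by linarith [hα.2.2, weight_le_one α]
  have h2 : ‖α - β‖ ≤ 2 * max ‖z - α‖ ‖z - β‖ := by
    have : α - β = (z - β) - (z - α) := by ring
    rw [this]
    refine (norm_sub_le _ _).trans ?_
    linarith [le_max_left ‖z - α‖ ‖z - β‖, le_max_right ‖z - α‖ ‖z - β‖]
  have h3 := Real.rpow_le_rpow (norm_nonneg _) h2 h0.le
  have hm : (max ‖z - α‖ ‖z - β‖) ^ ε < 1 / 2 := by
    rcases max_choice ‖z - α‖ ‖z - β‖ with h | h <;> rw [h]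
    exacts [hα.2.1, hβ.2.1]
  have hm0 : 0 ≤ (max ‖z - α‖ ‖z - β‖) ^ ε := by positivity
  rw [Real.mul_rpow (by norm_num) (by positivity)] at h3
  have h4 := two_rpow_le h0.le (by linarith : ε ≤ 1)
  nlinarith

/-- The collar is the region of size below 1/2, so up to time 1/4 nothing moves at its edge and the
pieces glue. -/
lemma two_mul_le_collarSize (hα : α ∈ algebraicNumbers) (h : ¬ InCollar α z ε) (hτ : τ ≤ 1 / 4) :
    2 * τ ≤ collarSize (weight α) α z ε := by
  rw [collarSize, le_max_iff]
  by_contra! h'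
  refine h ⟨hα, by linarith, ?_⟩
  have := h'.2
  rw [div_lt_iff₀ (weight_pos α)] at this
  nlinarith [weight_pos α]

open Classical in
/-- The deformation of the archimedean point `(z, ε)` at time `τ`. -/
def deform (z : ℂ) (ε τ : ℝ) (h : 0 < ε ∧ ε ≤ 1) : MulRingSeminorm ℂ[X] :=
  if h' : ∃ α, InCollar α z ε then collar (weight h'.choose) h'.choose z ε τ h
  else charSeminorm (evalRingHom z) ε h

lemma deform_of_inCollar (h : 0 < ε ∧ ε ≤ 1) (hα : InCollar α z ε) :
    deform z ε τ h = collar (weight α) α z ε τ h := by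
  have h' : ∃ α, InCollar α z ε := ⟨α, hα⟩
  rw [deform, dif_pos h', InCollar.unique h.1 h'.choose_spec hα]

lemma deform_of_not_inCollar (h : 0 < ε ∧ ε ≤ 1) (hα : ∀ α, ¬ InCollar α z ε) :
    deform z ε τ h = charSeminorm (evalRingHom z) ε h :=
  dif_neg (not_exists.2 hα)

lemma deform_zero (h : 0 < ε ∧ ε ≤ 1) : deform z ε 0 h = charSeminorm (evalRingHom z) ε h := by
  by_cases h' : ∃ α, InCollar α z ε
  · obtain ⟨α, hα⟩ := h'
    rw [deform_of_inCollar h hα, collar_eq_charSeminorm (weight_pos α) h]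
    rw [mul_zero]
    exact (collarSize_pos (weight_pos α) h.1).le
  · exact deform_of_not_inCollar h (not_exists.1 h')

lemma InCollar.conj (h : InCollar α z ε) : InCollar (starRingEnd ℂ α) (starRingEnd ℂ z) ε := by
  refine ⟨conj_mem_algebraicNumbers h.1, ?_, by rw [weight_conj]; exact h.2.2⟩
  rw [← map_sub, RCLike.norm_conj]
  exact h.2.1

lemma deform_conj (h : 0 < ε ∧ ε ≤ 1) (f : ℂ[X]) :
    deform (starRingEnd ℂ z) ε τ h (f.map (starRingEnd ℂ)) = deform z ε τ h f := by
  by_cases h' : ∃ α, InCollar α z ε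
  · obtain ⟨α, hα⟩ := h'
    rw [deform_of_inCollar h hα, deform_of_inCollar h hα.conj, weight_conj, collar_conj]
  · have h2 : ∀ α, ¬ InCollar α (starRingEnd ℂ z) ε := fun α hα =>
      h' ⟨starRingEnd ℂ α, by simpa using hα.conj⟩
    rw [deform_of_not_inCollar h (not_exists.1 h'), deform_of_not_inCollar h h2]
    simp only [charSeminorm_apply, coe_evalRingHom, eval_map_apply, RCLike.norm_conj]

lemma exists_deform_C (h : 0 < ε ∧ ε ≤ 1) (hτ : τ ≤ 1) :
    ∃ s : ℝ, 0 ≤ s ∧ s ≤ 1 ∧ ∀ c : ℂ, c ≠ 0 → deform z ε τ h (C c) = ‖c‖ ^ (s * ε) := by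
  by_cases h' : ∃ α, InCollar α z ε
  · obtain ⟨α, hα⟩ := h'
    refine ⟨_, (collarFactor_mem (weight α) α z ε τ).1, (collarFactor_mem (weight α) α z ε τ).2,
      fun c hc => ?_⟩
    rw [deform_of_inCollar h hα, collar_C (weight_pos α) h hτ hc]
  · exact ⟨1, zero_le_one, le_rfl, fun c _ => by
      rw [deform_of_not_inCollar h (not_exists.1 h')]; simp⟩

lemma tendsto_deform {ι : Type*} {l : Filter ι} {z : ι → ℂ} {ε τ : ι → ℝ} {z₀ : ℂ} {ε₀ τ₀ : ℝ}
    (hz : Tendsto z l (𝓝 z₀)) (hε : Tendsto ε l (𝓝 ε₀)) (hτ : Tendsto τ l (𝓝 τ₀))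
    (h : ∀ i, 0 < ε i ∧ ε i ≤ 1) (h₀ : 0 < ε₀ ∧ ε₀ ≤ 1) (hτ1 : ∀ i, τ i ≤ 1 / 4)
    (hτ₀ : τ₀ ≤ 1 / 4) (f : ℂ[X]) :
    Tendsto (fun i => deform (z i) (ε i) (τ i) (h i) f) l (𝓝 (deform z₀ ε₀ τ₀ h₀ f)) := by
  have hs : ∀ α, Tendsto (fun i => ‖z i - α‖ ^ ε i) l (𝓝 (‖z₀ - α‖ ^ ε₀)) := fun α =>
    (hz.sub_const α).norm.rpow hε (Or.inr h₀.1)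
  have hcol : ∀ α, Tendsto (fun i => collar (weight α) α (z i) (ε i) (τ i) (h i) f) l
      (𝓝 (collar (weight α) α z₀ ε₀ τ₀ h₀ f)) := fun α =>
    tendsto_collar hz hε hτ (weight_pos α) h h₀ (fun i => (hτ1 i).trans (by norm_num))
      (by linarith) f
  by_cases h' : ∃ α, InCollar α z₀ ε₀
  · obtain ⟨α, hα⟩ := h'
    rw [deform_of_inCollar h₀ hα]
    refine (tendsto_congr' ?_).2 (hcol α)
    filter_upwards [(hs α).eventually (gt_mem_nhds hα.2.1), hε.eventually (gt_mem_nhds hα.2.2)]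
      with i h1 h2
    rw [deform_of_inCollar (h i) ⟨hα.1, h1, h2⟩]
  · rw [not_exists] at h'
    rw [deform_of_not_inCollar h₀ h']
    have horig : Tendsto (fun i => charSeminorm (evalRingHom (z i)) (ε i) (h i) f) l
        (𝓝 (charSeminorm (evalRingHom z₀) ε₀ h₀ f)) :=
      ((f.continuous.tendsto z₀).comp hz).norm.rpow hε (Or.inr h₀.1)
    -- A collar that reaches exponents above ε₀/2 has weight above 2ε₀, so only finitely many
    -- collars come near the limit point, and all of them act trivially there.
    have hfin := finite_le_weight (κ := 2 * ε₀) (by linarith [h₀.1])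
    intro U hU
    rw [Filter.mem_map]
    have hcolU : ∀ᶠ i in l, ∀ α ∈ {α ∈ algebraicNumbers | 2 * ε₀ ≤ weight α},
        collar (weight α) α (z i) (ε i) (τ i) (h i) f ∈ U := by
      rw [hfin.eventually_all]
      intro α hα
      refine hcol α ?_
      rwa [collar_eq_charSeminorm (weight_pos α) h₀ (two_mul_le_collarSize hα.1 (h' α) hτ₀)]
    filter_upwards [horig hU, hcolU, hε.eventually (lt_mem_nhds (half_lt_self h₀.1))]
      with i h1 h2 h3
    change deform (z i) (ε i) (τ i) (h i) f ∈ U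
    by_cases h'' : ∃ α, InCollar α (z i) (ε i)
    · obtain ⟨α, hα⟩ := h''
      rw [deform_of_inCollar (h i) hα]
      refine h2 α ⟨hα.1, ?_⟩
      linarith [hα.2.2]
    · rw [deform_of_not_inCollar (h i) (not_exists.1 h'')]
      exact h1

lemma abs_rpow_sub_one_le {a b κ : ℝ} (ha : 0 < a) (h1 : a / 2 ≤ b) (h2 : b ≤ 2 * a) (hκ : 0 < κ)
    (hκ1 : κ ≤ 1 / 4) (hε0 : 0 ≤ ε) (hε : ε ≤ κ) (h : |a ^ ε - 1| ≤ κ) :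
    |b ^ ε - 1| ≤ 3 * κ := by
  have h3 := two_rpow_le hε0 (by linarith : ε ≤ 1)
  have hb : 0 ≤ b := by linarith
  have h4 := Real.rpow_le_rpow hb h2 hε0
  have h5 := Real.rpow_le_rpow ha.le (by linarith : a ≤ 2 * b) hε0
  rw [Real.mul_rpow (by norm_num) ha.le] at h4
  rw [Real.mul_rpow (by norm_num) hb] at h5
  have h6 : 0 ≤ b ^ ε := by positivity
  have h7 : 0 ≤ a ^ ε := by positivity
  rw [abs_le] at h ⊢
  constructor <;> nlinarith

/-- Uniformly in z and τ, the deformation approaches the formula of `thicken_X_sub_C`. Outside the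
collars |z - β|^ε ≥ 1/2 exceeds τ; in the collar at β the error is at most 2ε/d; in another collar
the values of T - β before and after are both close to 1. -/
lemma exists_forall_abs_deform_sub_le (hβ : β ∈ algebraicNumbers) {κ : ℝ} (hκ : 0 < κ) :
    ∃ ε₀ > (0 : ℝ), ∀ (z : ℂ) (ε τ : ℝ) (h : 0 < ε ∧ ε ≤ 1), 0 ≤ τ → τ ≤ 1 / 4 → ε < ε₀ →
      |deform z ε τ h (X - C β) - max (‖z - β‖ ^ ε) τ| ≤ κ := by
  -- Both powers will lie within 3κ' of 1: the bound κ/6 makes their difference at most κ, and the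
  -- bound 1/4 gives 1 - 3κ' ≥ 1/4 ≥ τ.
  set κ' := min (κ / 6) (1 / 4) with hκ'
  have hκ'0 : 0 < κ' := lt_min (by positivity) (by norm_num)
  have hκ'1 : κ' ≤ 1 / 4 := min_le_right _ _
  have hκ'2 : κ' ≤ κ / 6 := min_le_left _ _
  obtain ⟨ε₁, hε₁, hD⟩ := exists_forall_abs_rpow_sub_one_le hβ hκ'0
  have hwβ := weight_pos β
  refine ⟨min (min ε₁ κ') (min (weight β / 4) (κ * weight β / 2)),
    by simp only [gt_iff_lt, lt_min_iff]; refine ⟨⟨hε₁, hκ'0⟩, ?_, ?_⟩ <;> positivity, ?_⟩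
  intro z ε τ h hτ0 hτ1 hε
  simp only [lt_min_iff] at hε
  obtain ⟨⟨e1, e2⟩, e3, e4⟩ := hε
  have heval : ∀ y : ℂ, charSeminorm (evalRingHom y) ε h (X - C β) = ‖y - β‖ ^ ε := by
    intro y; simp
  by_cases h' : ∃ α, InCollar α z ε
  swap
  · rw [not_exists] at h'
    have h1 : 1 / 2 ≤ ‖z - β‖ ^ ε := by
      by_contra! hlt
      exact h' β ⟨hβ, hlt, e3⟩
    rw [deform_of_not_inCollar h h', heval, max_eq_left (by linarith), sub_self, abs_zero]
    exact hκ.le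
  obtain ⟨α, hα⟩ := h'
  rw [deform_of_inCollar h hα]
  rcases eq_or_ne α β with rfl | hne
  · rw [collar_X_sub_C_self hwβ h (by linarith), collarHeight]
    have h2 : 2 * ε / weight α ≤ κ := by
      rw [div_le_iff₀ hwβ]; linarith
    have h3 : 0 ≤ 2 * ε / weight α := by have := h.1; positivity
    refine (abs_max_sub_max_le_max _ _ _ _).trans (max_le (by simpa using hκ.le) ?_)
    rw [abs_le]
    constructor
    · have := le_max_right 0 (τ - 2 * ε / weight α)
      linarith
    · rw [sub_le_iff_le_add]
      exact max_le (by linarith) (by linarith)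
  · rw [collar_X_sub_C (weight_pos α) h (by linarith) hne.symm]
    have hwα : ε < weight α := by linarith [hα.2.2, weight_pos α]
    have hab : 0 < ‖α - β‖ := norm_pos_iff.2 (sub_ne_zero.2 hne)
    have hA := hD α hα.1 hne ε h.1 e1 hwα
    have hw : ‖z - α‖ < ‖α - β‖ / 2 := by
      have h5 := two_rpow_le h.1.le h.2
      have h6 : ‖α - β‖ ^ ε = 2 ^ ε * (‖α - β‖ / 2) ^ ε := by
        rw [← Real.mul_rpow (by norm_num) (by positivity)]; congr 1; ring
      have h7 := (abs_le.1 hA).1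
      have h8 : 0 ≤ (‖α - β‖ / 2) ^ ε := by positivity
      refine lt_of_not_ge fun hge => ?_
      have h9 := Real.rpow_le_rpow (by positivity) hge h.1.le
      have h10 := hα.2.1
      nlinarith
    have hw1 : ‖z - α‖ ≤ 1 := by
      by_contra! hgt
      have := Real.one_le_rpow hgt.le h.1.le
      linarith [hα.2.1]
    obtain ⟨ht0, ht1⟩ := collarFactor_mem (weight α) α z ε τ
    have near : ∀ y : ℂ, ‖y‖ ≤ ‖z - α‖ → ∀ ε', 0 ≤ ε' → ε' ≤ ε →
        |‖α + y - β‖ ^ ε' - 1| ≤ 3 * κ' := by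
      intro y hy ε' h0 h1
      have h2 : |‖α - β‖ ^ ε' - 1| ≤ κ' := by
        rcases h0.eq_or_lt with rfl | h0
        · simpa using hκ'0.le
        · exact hD α hα.1 hne ε' h0 (h1.trans_lt e1) (h1.trans_lt hwα)
      have h3 : ‖α + y - β‖ ≤ ‖α - β‖ + ‖y‖ := by
        rw [show α + y - β = (α - β) + y by ring]; exact norm_add_le _ _
      have h4 : ‖α - β‖ ≤ ‖α + y - β‖ + ‖y‖ := by
        have := norm_sub_le (α + y - β) y
        rwa [show α + y - β - y = α - β by ring] at this
      exact abs_rpow_sub_one_le hab (by linarith) (by linarith) hκ'0 hκ'1 h0 (by linarith) h2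
    have n1 := near _ (norm_radialScale_le hw1 ht0 ht1) _ (mul_nonneg ht0 h.1.le)
      (mul_le_of_le_one_left h.1.le ht1)
    have n2 := near (z - α) le_rfl ε h.1.le le_rfl
    rw [add_sub_cancel] at n2
    rw [abs_le] at n1 n2
    rw [max_eq_left (by linarith), abs_le]
    constructor <;> linarith

lemma tendsto_deform_X_sub_C (hβ : β ∈ algebraicNumbers) {ι : Type*} {l : Filter ι} {z : ι → ℂ}
    {ε τ : ι → ℝ} (h : ∀ i, 0 < ε i ∧ ε i ≤ 1) (hτ : ∀ i, 0 ≤ τ i ∧ τ i ≤ 1 / 4)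
    (hε : Tendsto ε l (𝓝 0)) {b : ℝ}
    (hb : Tendsto (fun i => max (‖z i - β‖ ^ ε i) (τ i)) l (𝓝 b)) :
    Tendsto (fun i => deform (z i) (ε i) (τ i) (h i) (X - C β)) l (𝓝 b) := by
  have : Tendsto (fun i => deform (z i) (ε i) (τ i) (h i) (X - C β) -
      max (‖z i - β‖ ^ ε i) (τ i)) l (𝓝 0) := by
    rw [Metric.tendsto_nhds]
    intro κ hκ
    obtain ⟨ε₀, h0, hε₀⟩ := exists_forall_abs_deform_sub_le hβ (half_pos hκ)
    filter_upwards [hε.eventually (gt_mem_nhds h0)] with i hi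
    rw [Real.dist_eq, sub_zero]
    exact (hε₀ _ _ _ (h i) (hτ i).1 (hτ i).2 hi).trans_lt (half_lt_self hκ)
  simpa using this.add hb

lemma tendsto_deform_C {c : ℂ} (hc : c ≠ 0) {ι : Type*} {l : Filter ι} {z : ι → ℂ}
    {ε τ : ι → ℝ} (h : ∀ i, 0 < ε i ∧ ε i ≤ 1) (hτ : ∀ i, τ i ≤ 1)
    (hε : Tendsto ε l (𝓝 0)) :
    Tendsto (fun i => deform (z i) (ε i) (τ i) (h i) (C c)) l (𝓝 1) := by
  choose s hs0 hs1 hs using fun i => exists_deform_C (z := z i) (h i) (hτ i)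
  simp only [hs _ c hc]
  have h1 : Tendsto (fun i => s i * ε i) l (𝓝 0) :=
    squeeze_zero (fun i => mul_nonneg (hs0 i) (h i).1.le)
      (fun i => mul_le_of_le_one_left (h i).1.le (hs1 i)) hε
  have := (tendsto_const_nhds (x := ‖c‖)).rpow h1 (Or.inl (norm_ne_zero_iff.2 hc))
  simpa using this

end Deformation

/-! ### The topology of pointwise convergence. -/

section Topology

variable {A : Type*} [CommRing A] {N : RingNorm A} {B : Type*} [CommRing B] [Algebra A B]

lemma isInducing_apply : IsInducing fun (x : Analytification N B) (f : B) => x.1 f := by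
  constructor
  rw [Pi.topologicalSpace, induced_iInf]
  simp only [induced_compose]
  rfl

lemma tendsto_analytification_iff {ι : Type*} {l : Filter ι} {y : ι → Analytification N B}
    {x : Analytification N B} :
    Tendsto y l (𝓝 x) ↔ ∀ f : B, Tendsto (fun i => (y i).1 f) l (𝓝 (x.1 f)) := by
  rw [isInducing_apply.tendsto_nhds_iff, tendsto_pi_nhds]
  rfl

lemma continuous_analytification_iff {Z : Type*} [TopologicalSpace Z]
    {y : Z → Analytification N B} :
    Continuous y ↔ ∀ f : B, Continuous fun z => (y z).1 f := by
  rw [isInducing_apply.continuous_iff, continuous_pi_iff]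
  rfl

lemma continuous_apply (f : B) : Continuous fun x : Analytification N B => x.1 f :=
  continuous_analytification_iff.1 continuous_id f

end Topology

/-- Equal norms at f and f + 1 give equal real parts and imaginary parts equal up to sign. The sign
is uniform because a group is not the union of two proper subgroups. -/
lemma eq_or_eq_conj_of_norm_eq {B : Type*} [CommRing B] {φ ψ : B →+* ℂ}
    (h : ∀ f, ‖φ f‖ = ‖ψ f‖) : φ = ψ ∨ φ = (starRingEnd ℂ).comp ψ := by
  have hn : ∀ f, Complex.normSq (φ f) = Complex.normSq (ψ f) := fun f => by
    rw [Complex.normSq_eq_norm_sq, Complex.normSq_eq_norm_sq, h]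
  have key : ∀ f, φ f = ψ f ∨ φ f = starRingEnd ℂ (ψ f) := fun f => by
    have h1 := hn f
    have h2 := hn (f + 1)
    simp only [map_add, map_one, Complex.normSq_apply, Complex.add_re, Complex.add_im,
      Complex.one_re, Complex.one_im] at h1 h2
    have hre : (φ f).re = (ψ f).re := by nlinarith
    have him : (φ f).im * (φ f).im = (ψ f).im * (ψ f).im := by rw [hre] at h1; linarith
    rcases mul_self_eq_mul_self_iff.1 him with h3 | h3
    · exact Or.inl (Complex.ext hre h3)
    · exact Or.inr (Complex.ext (by simpa using hre) (by simpa using h3))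
  by_contra! hne
  obtain ⟨f, hf⟩ := DFunLike.ne_iff.1 hne.1
  obtain ⟨g, hg⟩ := DFunLike.ne_iff.1 hne.2
  have hf' := (key f).resolve_left hf
  have hg' := (key g).resolve_right hg
  rcases key (f + g) with h | h
  · rw [map_add, map_add, hg'] at h
    exact hf (add_right_cancel h)
  · rw [map_add, map_add, map_add, hf'] at h
    exact hg (add_left_cancel h)

section Embedding

variable {K : Type*} [Field K]

/-- The embedding of the ring of integers induced by an embedding of the number field. -/
abbrev intEmbedding (σ : K →+* ℂ) : 𝓞 K →+* ℂ := σ.comp (algebraMap (𝓞 K) K)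

lemma intEmbedding_ne_zero (σ : K →+* ℂ) {a : 𝓞 K} (ha : a ≠ 0) : intEmbedding σ a ≠ 0 := by
  simpa using ha

/-- The deformation depends only on the point: the exponent is determined by the value at 2, and the
remaining data up to conjugation. -/
lemma deform_eq_of_charSeminorm_eq {σ σ' : K →+* ℂ} {z z' : ℂ} {ε ε' : ℝ} (h : 0 < ε ∧ ε ≤ 1)
    (h' : 0 < ε' ∧ ε' ≤ 1)
    (heq : ∀ f : (𝓞 K)[X], charSeminorm (evalRingHom z) ε h (f.map (intEmbedding σ)) =
      charSeminorm (evalRingHom z') ε' h' (f.map (intEmbedding σ'))) (τ : ℝ) (f : (𝓞 K)[X]) :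
    deform z ε τ h (f.map (intEmbedding σ)) = deform z' ε' τ h' (f.map (intEmbedding σ')) := by
  have hε : ε = ε' := by
    have := heq 2
    simp only [charSeminorm_apply, coe_evalRingHom, Polynomial.map_ofNat, eval_ofNat,
      RCLike.norm_ofNat] at this
    exact (Real.strictMono_rpow_of_base_gt_one (by norm_num)).injective this
  subst hε
  let φ := (evalRingHom z).comp (mapRingHom (intEmbedding σ))
  let ψ := (evalRingHom z').comp (mapRingHom (intEmbedding σ'))
  have hn : ∀ f, ‖φ f‖ = ‖ψ f‖ := fun f =>
    (Real.rpow_left_inj (norm_nonneg _) (norm_nonneg _) h.1.ne').1 (heq f)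
  rcases eq_or_eq_conj_of_norm_eq hn with e | e
  · have hz : z = z' := by simpa [φ, ψ] using DFunLike.congr_fun e X
    have hσ : intEmbedding σ = intEmbedding σ' := RingHom.ext fun a => by
      simpa [φ, ψ] using DFunLike.congr_fun e (C a)
    rw [hz, hσ]
  · have hz : z = starRingEnd ℂ z' := by simpa [φ, ψ] using DFunLike.congr_fun e X
    have hσ : intEmbedding σ = (starRingEnd ℂ).comp (intEmbedding σ') := RingHom.ext fun a => by
      simpa [φ, ψ] using DFunLike.congr_fun e (C a)
    rw [hz, hσ, ← Polynomial.map_map, deform_conj]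

end Embedding

/-! ### Points of the affine line and the homotopy `spread`. -/

section NumberField

variable {K : Type*} [Field K] [NumberField K]

/-- The ideal norm lies in the ideal, so control over integers gives control over all constants. -/
lemma exists_natCast_dvd {a : 𝓞 K} (ha : a ≠ 0) : ∃ n : ℕ, n ≠ 0 ∧ a ∣ (n : 𝓞 K) := by
  refine ⟨Ideal.absNorm (Ideal.span {a}), ?_, ?_⟩
  · rw [Ne, Ideal.absNorm_eq_zero_iff]
    simpa using ha
  · exact Ideal.mem_span_singleton.1 (Ideal.absNorm_mem _)

lemma norm_embedding_le (σ : K →+* ℂ) (a : 𝓞 K) : ‖σ (a : K)‖ ≤ archimedeanNorm K a :=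
  Finset.le_sup' (fun σ : K →+* ℂ => ‖σ (a : K)‖) (Finset.mem_univ σ)

/-- Kronecker: if all conjugates were smaller than 1, a would be a root of unity. This keeps powers
with exponent at most 1 bounded by the norm. -/
lemma one_le_archimedeanNorm {a : 𝓞 K} (ha : a ≠ 0) : 1 ≤ archimedeanNorm K a := by
  by_contra! hlt
  have hle : ∀ σ : K →+* ℂ, ‖σ (a : K)‖ < 1 := fun σ => (norm_embedding_le σ a).trans_lt hlt
  obtain ⟨n, hn, h⟩ := NumberField.Embeddings.pow_eq_one_of_norm_le_one K ℂ
    (x := (a : K)) (by simpa using ha) (NumberField.RingOfIntegers.isIntegral_coe a)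
    fun σ => (hle σ).le
  obtain ⟨σ⟩ : Nonempty (K →+* ℂ) := inferInstance
  have h1 : ‖σ (a : K)‖ ^ n = 1 := by rw [← norm_pow, ← map_pow, h]; simp
  have h2 := pow_lt_one₀ (norm_nonneg _) (hle σ) hn.ne'
  linarith

/-- A point of the affine line from a multiplicative seminorm bounded on nonzero constants. -/
def mkPoint (v : MulRingSeminorm (𝓞 K)[X]) (h : ∀ a : 𝓞 K, a ≠ 0 → v (C a) ≤ archimedeanNorm K a) :
    AffineLine (archimedeanNorm K) :=
  ⟨v, fun a => by
    rcases eq_or_ne a 0 with rfl | ha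
    · simp
    · exact h a ha⟩

@[simp] lemma mkPoint_apply (v : MulRingSeminorm (𝓞 K)[X]) (h) (f : (𝓞 K)[X]) :
    (mkPoint v h).1 f = v f := rfl

variable (K) in
/-- The nonarchimedean points of the affine line. -/
def nonarch : Set (AffineLine (archimedeanNorm K)) := {x | ∀ n : ℕ, x.1 n ≤ 1}

variable (K) in
/-- The points of the affine line lying over the archimedean branches or the central point of the
base. -/
def archClosure : Set (AffineLine (archimedeanNorm K)) := {x | ∀ n : ℕ, n ≠ 0 → 1 ≤ x.1 n}

lemma isClosed_nonarch : IsClosed (nonarch K) := by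
  simp only [nonarch, Set.ofPred_forall]
  exact isClosed_iInter fun n => isClosed_le (continuous_apply _) continuous_const

lemma isClosed_archClosure : IsClosed (archClosure K) := by
  simp only [archClosure, Set.ofPred_forall]
  exact isClosed_iInter fun n => isClosed_iInter fun _ =>
    isClosed_le continuous_const (continuous_apply _)

variable {x : AffineLine (archimedeanNorm K)}

lemma isNonarchimedean_of_mem (hx : x ∈ nonarch K) : IsNonarchimedean x.1 :=
  isNonarchimedean_of_natCast_le_one hx

lemma apply_C_le (a : 𝓞 K) : x.1 (C a) ≤ archimedeanNorm K a := x.2 a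

/-- In an integral equation for a, a value above 1 would make the leading term strictly dominate. -/
lemma apply_C_le_one (hx : x ∈ nonarch K) (a : 𝓞 K) : x.1 (C a) ≤ 1 := by
  by_contra! hlt
  have hna := isNonarchimedean_of_mem hx
  obtain ⟨p, hp, hpa⟩ := NumberField.RingOfIntegers.isIntegral a
  have h1 : a ^ p.natDegree = -∑ i ∈ Finset.range p.natDegree, (p.coeff i : 𝓞 K) * a ^ i := by
    rw [eval₂_eq_sum_range, Finset.sum_range_succ, hp.coeff_natDegree, map_one, one_mul] at hpa
    exact eq_neg_of_add_eq_zero_right hpa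
  have h2 := congrArg (fun b => x.1 (C b)) h1
  simp only [map_neg, map_neg_eq_map, map_sum, map_pow, map_mul] at h2
  rcases (Finset.range p.natDegree).eq_empty_or_nonempty with he | hne
  · rw [Finset.range_eq_empty_iff.1 he] at h2
    simp at h2
  obtain ⟨i, hi, hi2⟩ := IsNonarchimedean.finset_image_add_of_nonempty hna
    (fun i => C (p.coeff i : 𝓞 K) * C a ^ i) hne
  rw [← h2, map_mul, map_pow] at hi2
  have h3 : x.1 (C (p.coeff i : 𝓞 K)) ≤ 1 := by
    have h4 := hx (p.coeff i).natAbs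
    rcases Int.natAbs_eq (p.coeff i) with h5 | h5 <;> rw [h5]
    · simpa using h4
    · simpa using h4
  have h6 : x.1 (C a) ^ i < x.1 (C a) ^ p.natDegree := pow_lt_pow_right₀ hlt (Finset.mem_range.1 hi)
  have h7 : 0 ≤ x.1 (C a) ^ i := pow_nonneg (apply_nonneg _ _) i
  nlinarith

lemma apply_C_eq_one (hx : x ∈ nonarch K) (hx' : x ∈ archClosure K) {a : 𝓞 K} (ha : a ≠ 0) :
    x.1 (C a) = 1 := by
  refine le_antisymm (apply_C_le_one hx a) ?_
  obtain ⟨n, hn, b, hb⟩ := exists_natCast_dvd ha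
  have h1 := hx' n hn
  have h2 : ((n : ℕ) : (𝓞 K)[X]) = C a * C b := by rw [← map_mul, ← hb]; simp
  rw [h2, map_mul] at h1
  have h3 := apply_C_le_one hx b
  have h4 := apply_nonneg x.1 (C a)
  nlinarith

/-- The character is injective on constants, since a nonzero constant divides a nonzero integer, and
so extends to K. Nonarchimedean points receive dummy data to make the choice total. -/
lemma exists_archimedean_data (x : AffineLine (archimedeanNorm K)) :
    ∃ (σ : K →+* ℂ) (z : ℂ) (ε : ℝ) (h : 0 < ε ∧ ε ≤ 1), x ∉ nonarch K →
      ∀ f, x.1 f = charSeminorm (evalRingHom z) ε h (f.map (intEmbedding σ)) := by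
  by_cases hx : x ∈ nonarch K
  · obtain ⟨σ⟩ : Nonempty (K →+* ℂ) := inferInstance
    exact ⟨σ, 0, 1, ⟨one_pos, le_rfl⟩, fun h => absurd hx h⟩
  have hx' : ∃ n : ℕ, 1 < x.1 n := by
    by_contra! h
    exact hx h
  obtain ⟨φ, ε, h0, h1, h⟩ := exists_complex_character x.1 hx'
  have hinj : Function.Injective (φ.comp C) := by
    rw [injective_iff_map_eq_zero]
    intro a ha
    by_contra hne
    obtain ⟨n, hn, b, hb⟩ := exists_natCast_dvd hne
    have := congrArg (φ.comp C) hb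
    rw [map_mul, ha, zero_mul, map_natCast] at this
    exact hn (by exact_mod_cast this)
  refine ⟨IsFractionRing.lift hinj, φ X, ε, ⟨h0, h1⟩, fun _ f => ?_⟩
  rw [h, charSeminorm_apply]
  congr 2
  have e : φ = (evalRingHom (φ X)).comp (mapRingHom (intEmbedding (IsFractionRing.lift hinj))) := by
    refine Polynomial.ringHom_ext (fun a => ?_) ?_
    · simp [IsFractionRing.lift_algebraMap]
    · simp
  exact DFunLike.congr_fun e f

/-- The embedding attached to an archimedean point. -/
def embeddingOf (x : AffineLine (archimedeanNorm K)) : K →+* ℂ :=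
  (exists_archimedean_data x).choose

/-- The complex coordinate of an archimedean point. -/
def coordOf (x : AffineLine (archimedeanNorm K)) : ℂ :=
  (exists_archimedean_data x).choose_spec.choose

/-- The exponent of an archimedean point. -/
def exponentOf (x : AffineLine (archimedeanNorm K)) : ℝ :=
  (exists_archimedean_data x).choose_spec.choose_spec.choose

lemma exponentOf_mem (x : AffineLine (archimedeanNorm K)) : 0 < exponentOf x ∧ exponentOf x ≤ 1 :=
  (exists_archimedean_data x).choose_spec.choose_spec.choose_spec.choose

lemma apply_eq_charSeminorm (hx : x ∉ nonarch K) (f : (𝓞 K)[X]) :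
    x.1 f = charSeminorm (evalRingHom (coordOf x)) (exponentOf x) (exponentOf_mem x)
      (f.map (intEmbedding (embeddingOf x))) :=
  (exists_archimedean_data x).choose_spec.choose_spec.choose_spec.choose_spec hx f

lemma apply_natCast (hx : x ∉ nonarch K) (n : ℕ) : x.1 n = (n : ℝ) ^ exponentOf x := by
  rw [apply_eq_charSeminorm hx]; simp

lemma mem_archClosure_of_notMem (hx : x ∉ nonarch K) : x ∈ archClosure K := fun n hn => by
  rw [apply_natCast hx]
  exact Real.one_le_rpow (by exact_mod_cast Nat.one_le_iff_ne_zero.2 hn) (exponentOf_mem x).1.le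

lemma nonarch_union_archClosure : nonarch K ∪ archClosure K = Set.univ := by
  rw [Set.eq_univ_iff_forall]
  intro x
  by_cases hx : x ∈ nonarch K
  exacts [Or.inl hx, Or.inr (mem_archClosure_of_notMem hx)]

lemma exponentOf_eq (hx : x ∉ nonarch K) : exponentOf x = Real.logb 2 (x.1 (2 : ℕ)) := by
  rw [apply_natCast hx, Nat.cast_ofNat, Real.logb_rpow (by norm_num) (by norm_num)]

lemma quarter_mem (τ : unitInterval) : 0 ≤ (τ : ℝ) / 4 ∧ (τ : ℝ) / 4 ≤ 1 / 4 :=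
  ⟨by linarith [τ.2.1], by linarith [τ.2.2]⟩

open Classical in
/-- The deformation of the affine line which pushes all points away from the points with nonzero
kernel over the central point of the base. -/
def spread (x : AffineLine (archimedeanNorm K)) (τ : unitInterval) :
    AffineLine (archimedeanNorm K) :=
  if hx : x ∈ nonarch K then
    mkPoint (thicken x.1 (isNonarchimedean_of_mem hx) (τ / 4) (quarter_mem τ).1) fun a _ => by
      rw [thicken_C]; exact apply_C_le a
  else
    mkPoint (seminormComp (deform (coordOf x) (exponentOf x) (τ / 4) (exponentOf_mem x))
      (mapRingHom (intEmbedding (embeddingOf x)))) fun a ha => by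
        obtain ⟨s, hs0, hs1, hs⟩ := exists_deform_C (z := coordOf x) (τ := τ / 4) (exponentOf_mem x)
          ((quarter_mem τ).2.trans (by norm_num))
        rw [seminormComp_apply, coe_mapRingHom, map_C, hs _ (intEmbedding_ne_zero _ ha)]
        have h0 := exponentOf_mem x
        have h1 := one_le_archimedeanNorm ha
        calc ‖intEmbedding (embeddingOf x) a‖ ^ (s * exponentOf x)
            ≤ archimedeanNorm K a ^ (s * exponentOf x) :=
              Real.rpow_le_rpow (norm_nonneg _) (norm_embedding_le _ _) (mul_nonneg hs0 h0.1.le)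
          _ ≤ archimedeanNorm K a ^ (1 : ℝ) :=
              Real.rpow_le_rpow_of_exponent_le h1 (mul_le_one₀ hs1 h0.1.le h0.2)
          _ = _ := Real.rpow_one _

lemma spread_apply_of_mem (hx : x ∈ nonarch K) (τ : unitInterval) (f : (𝓞 K)[X]) :
    (spread x τ).1 f =
      thicken x.1 (isNonarchimedean_of_mem hx) (τ / 4) (quarter_mem τ).1 f := by
  rw [spread, dif_pos hx]; rfl

lemma spread_apply_of_notMem (hx : x ∉ nonarch K) (τ : unitInterval) (f : (𝓞 K)[X]) :
    (spread x τ).1 f = deform (coordOf x) (exponentOf x) (τ / 4) (exponentOf_mem x)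
      (f.map (intEmbedding (embeddingOf x))) := by
  rw [spread, dif_neg hx]; rfl

lemma spread_zero (x : AffineLine (archimedeanNorm K)) : spread x 0 = x := by
  refine Subtype.ext (MulRingSeminorm.ext fun f => ?_)
  by_cases hx : x ∈ nonarch K
  · rw [spread_apply_of_mem hx]
    simp only [Set.Icc.coe_zero, zero_div]
    exact thicken_zero _ _ _
  · rw [spread_apply_of_notMem hx, apply_eq_charSeminorm hx]
    simp only [Set.Icc.coe_zero, zero_div]
    rw [deform_zero]

/-- Only linear factors at algebraic numbers occur, which is why countably many collars suffice. -/
lemma mem_algebraicNumbers_of_mem_roots (σ : K →+* ℂ) {f : (𝓞 K)[X]} {β : ℂ}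
    (hβ : β ∈ (f.map (intEmbedding σ)).roots) : β ∈ algebraicNumbers := by
  let _ : Algebra K ℂ := σ.toAlgebra
  have h0 := ne_zero_of_mem_roots hβ
  have h1 : IsAlgebraic K β := by
    refine ⟨f.map (algebraMap (𝓞 K) K), ?_, ?_⟩
    · rintro h
      apply h0
      rw [← Polynomial.map_map, h, Polynomial.map_zero]
    · have := (mem_roots'.1 hβ).2
      rw [IsRoot.def, ← Polynomial.map_map, eval_map] at this
      exact this
  exact IsAlgebraic.restrictScalars ℚ h1

/-! ### Continuity of `spread` along ultrafilters. -/

section Continuity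

variable {ι : Type*} {U : Ultrafilter ι} {y : ι → AffineLine (archimedeanNorm K)}
  {τ : ι → unitInterval} {τ₀ : unitInterval}

lemma tendsto_spread_of_mem (hy : ∀ᶠ i in U, y i ∈ nonarch K) (hyx : Tendsto y U (𝓝 x))
    (hτ : Tendsto τ U (𝓝 τ₀)) (f : (𝓞 K)[X]) :
    Tendsto (fun i => (spread (y i) (τ i)).1 f) U (𝓝 ((spread x τ₀).1 f)) := by
  have hx : x ∈ nonarch K := isClosed_nonarch.mem_of_tendsto hyx hy
  rw [spread_apply_of_mem hx]
  have hτ' : Tendsto (fun i => (τ i : ℝ) / 4) U (𝓝 ((τ₀ : ℝ) / 4)) :=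
    ((continuous_subtype_val.tendsto _).comp hτ).div_const 4
  refine (tendsto_congr' ?_).2 (tendsto_gaussNorm (v := fun i => (y i).1) (w := x.1)
    (translation (𝓞 K) f) (fun k => tendsto_analytification_iff.1 hyx _) hτ')
  filter_upwards [hy] with i hi
  rw [spread_apply_of_mem hi]
  rfl

lemma tendsto_exponentOf (hy : ∀ᶠ i in U, y i ∉ nonarch K) (hyx : Tendsto y U (𝓝 x)) :
    Tendsto (fun i => exponentOf (y i)) U (𝓝 (Real.logb 2 (x.1 (2 : ℕ)))) := by
  have h1 := tendsto_analytification_iff.1 hyx (2 : ℕ)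
  have hx : x ∈ archClosure K :=
    isClosed_archClosure.mem_of_tendsto hyx (hy.mono fun i hi => mem_archClosure_of_notMem hi)
  refine (tendsto_congr' ?_).2 (h1.logb (b := 2) ?_)
  · filter_upwards [hy] with i hi using exponentOf_eq hi
  · linarith [hx 2 two_ne_zero]

/-- There are only finitely many embeddings, so an ultrafilter selects one. -/
lemma exists_eventually_embeddingOf (U : Ultrafilter ι) (y : ι → AffineLine (archimedeanNorm K)) :
    ∃ σ : K →+* ℂ, ∀ᶠ i in U, embeddingOf (y i) = σ := by
  obtain ⟨σ, hσ⟩ := Ultrafilter.eq_pure_of_finite (U.map fun i => embeddingOf (y i))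
  refine ⟨σ, ?_⟩
  have : ({σ} : Set (K →+* ℂ)) ∈ U.map fun i => embeddingOf (y i) := by rw [hσ]; simp
  exact this

lemma tendsto_spread_of_notMem (hy : ∀ᶠ i in U, y i ∉ nonarch K) (hyx : Tendsto y U (𝓝 x))
    (hx : x ∉ nonarch K) (hτ : Tendsto τ U (𝓝 τ₀)) (f : (𝓞 K)[X]) :
    Tendsto (fun i => (spread (y i) (τ i)).1 f) U (𝓝 ((spread x τ₀).1 f)) := by
  have hε := tendsto_exponentOf hy hyx
  rw [← exponentOf_eq hx] at hε
  have h0 := exponentOf_mem x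
  obtain ⟨σ, hσ⟩ := exists_eventually_embeddingOf U y
  have hz : ∀ᶠ i in U, coordOf (y i) ∈ Metric.closedBall (0 : ℂ)
      (x.1 X ^ (exponentOf x)⁻¹ + 1) := by
    have h1 := (tendsto_analytification_iff.1 hyx X).rpow (hε.inv₀ h0.1.ne')
      (Or.inr (inv_pos.2 h0.1))
    filter_upwards [h1.eventually (gt_mem_nhds (lt_add_one _)), hy] with i hi hi2
    rw [apply_eq_charSeminorm hi2] at hi
    simp only [Polynomial.map_X, charSeminorm_apply, coe_evalRingHom, eval_X] at hi
    rw [Real.rpow_rpow_inv (norm_nonneg _) (exponentOf_mem _).1.ne'] at hi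
    simpa using hi.le
  obtain ⟨z, -, hzl⟩ := (isCompact_closedBall (0 : ℂ) _).ultrafilter_le_nhds
    (U.map fun i => coordOf (y i)) (le_principal_iff.2 hz)
  have hzl : Tendsto (fun i => coordOf (y i)) U (𝓝 z) := hzl
  have hτ' : Tendsto (fun i => (τ i : ℝ) / 4) U (𝓝 ((τ₀ : ℝ) / 4)) :=
    ((continuous_subtype_val.tendsto _).comp hτ).div_const 4
  have hrep : ∀ f, x.1 f = charSeminorm (evalRingHom z) (exponentOf x) h0
      (f.map (intEmbedding σ)) := fun f => by
    refine tendsto_nhds_unique (tendsto_analytification_iff.1 hyx f) ?_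
    have h1 : Tendsto (fun i => ‖(f.map (intEmbedding σ)).eval (coordOf (y i))‖ ^
        exponentOf (y i)) U (𝓝 (‖(f.map (intEmbedding σ)).eval z‖ ^ exponentOf x)) :=
      (((f.map (intEmbedding σ)).continuous.tendsto z).comp hzl).norm.rpow hε (Or.inr h0.1)
    refine (tendsto_congr' ?_).2 h1
    filter_upwards [hy, hσ] with i hi hi2
    rw [apply_eq_charSeminorm hi, hi2]
    rfl
  -- The limiting embedding and coordinate may be the conjugates of those chosen for x.
  rw [spread_apply_of_notMem hx, deform_eq_of_charSeminorm_eq (exponentOf_mem x) h0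
    (fun f => by rw [← hrep, ← apply_eq_charSeminorm hx])]
  refine (tendsto_congr' ?_).2 (tendsto_deform hzl hε hτ' (fun i => exponentOf_mem (y i)) h0
    (fun i => (quarter_mem (τ i)).2) (quarter_mem τ₀).2 (f.map (intEmbedding σ)))
  filter_upwards [hy, hσ] with i hi hi2
  rw [spread_apply_of_notMem hi, hi2]

lemma tendsto_spread_of_notMem_of_mem (hy : ∀ᶠ i in U, y i ∉ nonarch K) (hyx : Tendsto y U (𝓝 x))
    (hx : x ∈ nonarch K) (hτ : Tendsto τ U (𝓝 τ₀)) (f : (𝓞 K)[X]) :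
    Tendsto (fun i => (spread (y i) (τ i)).1 f) U (𝓝 ((spread x τ₀).1 f)) := by
  rcases eq_or_ne f 0 with rfl | hf
  · simp
  have hε := tendsto_exponentOf hy hyx
  have hxY : x ∈ archClosure K :=
    isClosed_archClosure.mem_of_tendsto hyx (hy.mono fun i hi => mem_archClosure_of_notMem hi)
  rw [le_antisymm (hx 2) (hxY 2 two_ne_zero), Real.logb_one] at hε
  obtain ⟨σ, hσ⟩ := exists_eventually_embeddingOf U y
  have hτ' : Tendsto (fun i => (τ i : ℝ) / 4) U (𝓝 ((τ₀ : ℝ) / 4)) :=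
    ((continuous_subtype_val.tendsto _).comp hτ).div_const 4
  let v : ι → MulRingSeminorm ℂ[X] := fun i =>
    charSeminorm (evalRingHom (coordOf (y i))) (exponentOf (y i)) (exponentOf_mem (y i))
  have hvC : ∀ c : ℂ, c ≠ 0 → Tendsto (fun i => v i (C c)) U (𝓝 1) := fun c hc => by
    have := (tendsto_const_nhds (x := ‖c‖)).rpow hε (Or.inl (norm_ne_zero_iff.2 hc))
    simpa [v] using this
  have hbdd : ∀ f : ℂ[X], ∃ c : ℝ, ∀ᶠ i in U, v i f ≤ c := by
    intro f
    induction f using Polynomial.induction_on' with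
    | add p q hp hq =>
      obtain ⟨c, hc⟩ := hp
      obtain ⟨c', hc'⟩ := hq
      refine ⟨c + c', ?_⟩
      filter_upwards [hc, hc'] with i h1 h2
      exact (map_add_le_add (v i) p q).trans (add_le_add h1 h2)
    | monomial n c =>
      rcases eq_or_ne c 0 with rfl | hc
      · exact ⟨0, by simp⟩
      have h1 : Tendsto (fun i => v i X) U (𝓝 (x.1 X)) := by
        refine (tendsto_congr' ?_).1 (tendsto_analytification_iff.1 hyx X)
        filter_upwards [hy] with i hi
        rw [apply_eq_charSeminorm hi, Polynomial.map_X]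
      have h2 := (hvC c hc).mul (h1.pow n)
      refine ⟨1 * x.1 X ^ n + 1, (h2.eventually (gt_mem_nhds (lt_add_one _))).mono fun i hi => ?_⟩
      rw [← C_mul_X_pow_eq_monomial, map_mul, map_pow]
      exact hi.le
  -- The limit is taken on ℂ[T], where f splits: w is a seminorm over trivially valued ℂ that
  -- restricts to x along σ.
  obtain ⟨w, hw⟩ := exists_seminorm_lim U v hbdd
  have hwC : ∀ c : ℂ, c ≠ 0 → w (C c) = 1 := fun c hc => tendsto_nhds_unique (hw _) (hvC c hc)
  have hwna : IsNonarchimedean w := isNonarchimedean_of_natCast_le_one fun n => by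
    rcases eq_or_ne n 0 with rfl | hn
    · simp
    · rw [← C_eq_natCast]
      exact (hwC _ (by exact_mod_cast hn)).le
  have hxw : ∀ f, x.1 f = w (f.map (intEmbedding σ)) := fun f => by
    refine tendsto_nhds_unique (tendsto_analytification_iff.1 hyx f) ?_
    refine (tendsto_congr' ?_).2 (hw _)
    filter_upwards [hy, hσ] with i hi hi2
    rw [apply_eq_charSeminorm hi, hi2]
  have hq := quarter_mem τ₀
  rw [spread_apply_of_mem hx, thicken_map _ w x.1 hxw hwna]
  have h1 : Tendsto (fun i => deform (coordOf (y i)) (exponentOf (y i)) (τ i / 4)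
      (exponentOf_mem (y i)) (f.map (intEmbedding σ))) U
      (𝓝 (thicken w hwna (τ₀ / 4) hq.1 (f.map (intEmbedding σ)))) := by
    apply tendsto_of_tendsto_linear
    · intro c hc
      rw [thicken_C, hwC c hc]
      exact tendsto_deform_C hc _ (fun i => (quarter_mem (τ i)).2.trans (by norm_num)) hε
    · intro β hβ
      rw [thicken_X_sub_C]
      refine tendsto_deform_X_sub_C (mem_algebraicNumbers_of_mem_roots σ hβ) _
        (fun i => quarter_mem (τ i)) hε (Tendsto.max ?_ hτ')
      refine (hw (X - C β)).congr fun i => ?_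
      simp [v]
  refine (tendsto_congr' ?_).2 h1
  filter_upwards [hy, hσ] with i hi hi2
  rw [spread_apply_of_notMem hi, hi2]

end Continuity

theorem continuous_spread :
    Continuous fun p : AffineLine (archimedeanNorm K) × unitInterval => spread p.1 p.2 := by
  rw [continuous_iff_continuousAt]
  rintro ⟨x, τ₀⟩
  rw [ContinuousAt, tendsto_iff_ultrafilter]
  intro U hU
  rw [tendsto_analytification_iff]
  intro f
  have h1 : Tendsto Prod.fst (U : Filter (AffineLine (archimedeanNorm K) × unitInterval)) (𝓝 x) :=
    (continuous_fst.tendsto (x, τ₀)).mono_left hU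
  have h2 : Tendsto Prod.snd (U : Filter (AffineLine (archimedeanNorm K) × unitInterval)) (𝓝 τ₀) :=
    (continuous_snd.tendsto (x, τ₀)).mono_left hU
  rcases U.em fun p => p.1 ∈ nonarch K with h | h
  · exact tendsto_spread_of_mem h h1 h2 f
  · by_cases hx : x ∈ nonarch K
    · exact tendsto_spread_of_notMem_of_mem h h1 hx h2 f
    · exact tendsto_spread_of_notMem h h1 hx h2 f

end NumberField

/-! ### Orders at primes of a Dedekind domain. -/

section OrderOfVanishing

variable {R : Type*} [CommRing R] [IsDedekindDomain R]

/-- The order of an element at an ideal. -/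
def idealOrd (P : Ideal R) (a : R) : ℕ := multiplicity P (Ideal.span {a})

/-- The zero ideal is allowed as it is the residue ideal of central points. -/
lemma idealOrd_bot {a : R} (ha : a ≠ 0) : idealOrd (⊥ : Ideal R) a = 0 := by
  rw [idealOrd, multiplicity_eq_zero, Ideal.dvd_span_singleton]
  simpa using ha

variable {P : Ideal R} [hP : P.IsPrime]

lemma finiteMultiplicity_ideal (hP0 : P ≠ ⊥) {a : R} (ha : a ≠ 0) :
    FiniteMultiplicity P (Ideal.span {a}) :=
  FiniteMultiplicity.of_prime_left (Ideal.prime_of_isPrime hP0 hP) (by simpa using ha)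

lemma le_idealOrd_iff (hP0 : P ≠ ⊥) {a : R} (ha : a ≠ 0) {n : ℕ} :
    n ≤ idealOrd P a ↔ a ∈ P ^ n := by
  rw [← Ideal.dvd_span_singleton,
    (finiteMultiplicity_ideal hP0 ha).pow_dvd_iff_le_multiplicity]
  rfl

lemma idealOrd_eq_zero_iff (hP0 : P ≠ ⊥) {a : R} (ha : a ≠ 0) : idealOrd P a = 0 ↔ a ∉ P := by
  have := le_idealOrd_iff hP0 ha (n := 1)
  rw [pow_one] at this
  rw [← this]; omega

lemma idealOrd_mul {a b : R} (ha : a ≠ 0) (hb : b ≠ 0) :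
    idealOrd P (a * b) = idealOrd P a + idealOrd P b := by
  rcases eq_or_ne P ⊥ with rfl | hP0
  · rw [idealOrd_bot ha, idealOrd_bot hb, idealOrd_bot (mul_ne_zero ha hb)]
  rw [idealOrd, ← Ideal.span_singleton_mul_span_singleton]
  exact multiplicity_mul (Ideal.prime_of_isPrime hP0 hP)
    (by rw [Ideal.span_singleton_mul_span_singleton]
        exact finiteMultiplicity_ideal hP0 (mul_ne_zero ha hb))

lemma idealOrd_pow (hP0 : P ≠ ⊥) {a : R} (ha : a ≠ 0) (n : ℕ) :
    idealOrd P (a ^ n) = n * idealOrd P a := by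
  induction n with
  | zero =>
    rw [pow_zero, zero_mul, idealOrd_eq_zero_iff hP0 one_ne_zero]
    exact (Ideal.ne_top_iff_one P).1 hP.ne_top
  | succ n ih => rw [pow_succ, idealOrd_mul (pow_ne_zero n ha) ha, ih]; ring

lemma min_le_idealOrd_add {a b : R} (ha : a ≠ 0) (hb : b ≠ 0) (hab : a + b ≠ 0) :
    min (idealOrd P a) (idealOrd P b) ≤ idealOrd P (a + b) := by
  rcases eq_or_ne P ⊥ with rfl | hP0
  · rw [idealOrd_bot ha]; simp
  rw [le_idealOrd_iff hP0 hab]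
  exact Ideal.add_mem _ ((le_idealOrd_iff hP0 ha).1 (min_le_left _ _))
    ((le_idealOrd_iff hP0 hb).1 (min_le_right _ _))

/-- A multiplicative seminorm on a Dedekind domain bounded by `1` is a power of the order at its
residue ideal. -/
lemma exists_eq_pow_idealOrd (v : MulRingSeminorm R) (h1 : ∀ a, v a ≤ 1)
    (hv : ∀ a, v a < 1 ↔ a ∈ P) :
    ∃ q : ℝ, 0 ≤ q ∧ q ≤ 1 ∧ ∀ a, a ≠ 0 → v a = q ^ idealOrd P a := by
  have hone : ∀ a, a ∉ P → v a = 1 := fun a ha =>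
    le_antisymm (h1 a) (not_lt.1 fun h => ha ((hv a).1 h))
  rcases eq_or_ne P ⊥ with rfl | hP0
  · refine ⟨1, zero_le_one, le_rfl, fun a ha => ?_⟩
    rw [one_pow, hone a (by simpa using ha)]
  -- An element p of order 1 and an element y outside P that clears the other primes of p give a y^n
  -- = p^n c with c outside P, so a has the value of p^n.
  obtain ⟨p, hp, hp2⟩ := Ideal.exists_mem_pow_notMem_pow_succ P hP0 hP.ne_top 1
  rw [pow_one] at hp
  have hp0 : p ≠ 0 := by rintro rfl; exact hp2 (zero_mem _)
  refine ⟨v p, apply_nonneg _ _, h1 p, fun a ha => ?_⟩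
  have hpord : idealOrd P p = 1 := by
    have e1 := (le_idealOrd_iff hP0 hp0 (n := 1)).2 (by rwa [pow_one])
    have e2 := mt (le_idealOrd_iff hP0 hp0 (n := 1 + 1)).1 hp2
    omega
  obtain ⟨J, hJ⟩ := Ideal.dvd_span_singleton.2 hp
  obtain ⟨y, hyJ, hyP⟩ : ∃ y ∈ J, y ∉ P := by
    by_contra! h
    have hJP : P ∣ J := Ideal.dvd_iff_le.2 h
    apply hp2
    rw [← Ideal.dvd_span_singleton, hJ, pow_add, pow_one]
    exact mul_dvd_mul_left P hJP
  have hy0 : y ≠ 0 := by rintro rfl; exact hyP (zero_mem _)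
  set n := idealOrd P a with hn
  have hmem : a * y ^ n ∈ Ideal.span {p ^ n} := by
    rw [← Ideal.span_singleton_pow, hJ, mul_pow]
    exact Ideal.mul_mem_mul ((le_idealOrd_iff hP0 ha).1 le_rfl) (Ideal.pow_mem_pow hyJ n)
  obtain ⟨c, hc⟩ := Ideal.mem_span_singleton.1 hmem
  have hne : a * y ^ n ≠ 0 := mul_ne_zero ha (pow_ne_zero n hy0)
  have hc0 : c ≠ 0 := by rintro rfl; rw [mul_zero] at hc; exact hne hc
  have hord := congrArg (idealOrd P) hc
  rw [idealOrd_mul ha (pow_ne_zero n hy0), idealOrd_mul (pow_ne_zero n hp0) hc0,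
    idealOrd_pow hP0 hy0, idealOrd_pow hP0 hp0, hpord, (idealOrd_eq_zero_iff hP0 hy0).2 hyP] at hord
  have hcP : c ∉ P := (idealOrd_eq_zero_iff hP0 hc0).1 (by omega)
  have hval := congrArg v hc
  rw [map_mul, map_mul, map_pow, map_pow, hone y hyP, hone c hcP] at hval
  simpa using hval

/-- The seminorm `a ↦ max |a| (s ^ ord_P a)`, for `P` the residue ideal of a seminorm bounded
by `1`. -/
def raiseSeminorm (v : MulRingSeminorm R) (h1 : ∀ a, v a ≤ 1) (hv : ∀ a, v a < 1 ↔ a ∈ P)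
    (s : ℝ) (hs0 : 0 ≤ s) (hs1 : s ≤ 1) : MulRingSeminorm R := by
  classical
  -- Both terms are powers with the same exponent, so their maximum is again such a power, and
  -- therefore multiplicative.
  have key : ∃ q : ℝ, 0 ≤ q ∧ q ≤ 1 ∧
      ∀ a, a ≠ 0 → max (v a) (s ^ idealOrd P a) = q ^ idealOrd P a := by
    obtain ⟨q, hq0, hq1, hq⟩ := exists_eq_pow_idealOrd v h1 hv
    refine ⟨max q s, le_max_of_le_left hq0, max_le hq1 hs1, fun a ha => ?_⟩
    rw [hq a ha]
    rcases le_total q s with h | h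
    · rw [max_eq_right h, max_eq_right (pow_le_pow_left₀ hq0 h _)]
    · rw [max_eq_left h, max_eq_left (pow_le_pow_left₀ hs0 h _)]
  refine seminormOf (fun a => if a = 0 then 0 else max (v a) (s ^ idealOrd P a)) (by simp) ?_
    (fun a => ?_) (fun a b => ?_) fun a b => ?_
  · rw [if_neg one_ne_zero, map_one]
    exact max_eq_left (pow_le_one₀ hs0 hs1)
  · split_ifs
    exacts [le_rfl, le_max_of_le_left (apply_nonneg v a)]
  all_goals
    obtain ⟨q, hq0, hq1, hq⟩ := key
    by_cases ha : a = 0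
    · simp [ha]
    by_cases hb : b = 0
    · simp [hb]
  · rw [if_neg ha, if_neg hb, if_neg (mul_ne_zero ha hb), hq a ha, hq b hb,
      hq _ (mul_ne_zero ha hb), idealOrd_mul ha hb, pow_add]
  · rw [if_neg ha, if_neg hb, hq a ha, hq b hb]
    have e1 : 0 ≤ q ^ idealOrd P a := by positivity
    have e2 : 0 ≤ q ^ idealOrd P b := by positivity
    by_cases hab : a + b = 0
    · rw [if_pos hab]; positivity
    rw [if_neg hab, hq _ hab]
    refine (pow_le_pow_of_le_one hq0 hq1 (min_le_idealOrd_add ha hb hab)).trans ?_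
    rcases min_choice (idealOrd P a) (idealOrd P b) with h | h <;> rw [h] <;> linarith

lemma raiseSeminorm_apply (v : MulRingSeminorm R) (h1 : ∀ a, v a ≤ 1) (hv : ∀ a, v a < 1 ↔ a ∈ P)
    (s : ℝ) (hs0 : 0 ≤ s) (hs1 : s ≤ 1) {a : R} (ha : a ≠ 0) :
    raiseSeminorm v h1 hv s hs0 hs1 a = max (v a) (s ^ idealOrd P a) := if_neg ha

end OrderOfVanishing

/-! ### Collapsing the central fibre and contracting the archimedean half. -/

section Contraction

variable {K : Type*} [Field K] [NumberField K] {x : AffineLine (archimedeanNorm K)}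

/-- The power of a point of the affine line. -/
def powPoint (x : AffineLine (archimedeanNorm K)) (t : unitInterval) :
    AffineLine (archimedeanNorm K) :=
  mkPoint (seminormPow x.1 t t.2.1 t.2.2) fun a ha => by
    rw [seminormPow_apply _ _ _ _ (C_ne_zero.2 ha)]
    calc x.1 (C a) ^ (t : ℝ) ≤ archimedeanNorm K a ^ (t : ℝ) :=
          Real.rpow_le_rpow (apply_nonneg _ _) (apply_C_le a) t.2.1
      _ ≤ archimedeanNorm K a ^ (1 : ℝ) :=
          Real.rpow_le_rpow_of_exponent_le (one_le_archimedeanNorm ha) t.2.2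
      _ = _ := Real.rpow_one _

lemma powPoint_apply (x : AffineLine (archimedeanNorm K)) (t : unitInterval) {f : (𝓞 K)[X]}
    (hf : f ≠ 0) : (powPoint x t).1 f = x.1 f ^ (t : ℝ) :=
  seminormPow_apply x.1 t t.2.1 t.2.2 hf

lemma ext_of_ne_zero {y : AffineLine (archimedeanNorm K)}
    (h : ∀ f : (𝓞 K)[X], f ≠ 0 → x.1 f = y.1 f) : x = y := by
  refine Subtype.ext (MulRingSeminorm.ext fun f => ?_)
  rcases eq_or_ne f 0 with rfl | hf
  · simp
  · exact h f hf

lemma powPoint_one (x : AffineLine (archimedeanNorm K)) : powPoint x 1 = x :=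
  ext_of_ne_zero fun f hf => by rw [powPoint_apply x 1 hf]; simp

variable (K) in
open Classical in
/-- The point of the affine line given by the trivial norm. -/
def trivialPoint : AffineLine (archimedeanNorm K) :=
  mkPoint 1 fun a ha => by
    rw [MulRingSeminorm.apply_one, if_neg (C_ne_zero.2 ha)]
    exact one_le_archimedeanNorm ha

lemma trivialPoint_apply {f : (𝓞 K)[X]} (hf : f ≠ 0) : (trivialPoint K).1 f = 1 := by
  classical
  rw [trivialPoint, mkPoint_apply, MulRingSeminorm.apply_one, if_neg hf]

lemma powPoint_zero (x : AffineLine (archimedeanNorm K)) : powPoint x 0 = trivialPoint K :=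
  ext_of_ne_zero fun f hf => by rw [powPoint_apply x 0 hf, trivialPoint_apply hf]; simp

/-- The only obstruction to joint continuity of the power is base 0 with exponent 0. -/
lemma tendsto_powPoint {ι : Type*} {l : Filter ι} {y : ι → AffineLine (archimedeanNorm K)}
    {t : ι → unitInterval} {t₀ : unitInterval} (hy : Tendsto y l (𝓝 x)) (ht : Tendsto t l (𝓝 t₀))
    (h : t₀ = 0 → ∀ f : (𝓞 K)[X], f ≠ 0 → 0 < x.1 f) :
    Tendsto (fun i => powPoint (y i) (t i)) l (𝓝 (powPoint x t₀)) := by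
  rw [tendsto_analytification_iff] at hy ⊢
  intro f
  rcases eq_or_ne f 0 with rfl | hf
  · simpa using tendsto_const_nhds
  simp only [powPoint_apply _ _ hf]
  refine (hy f).rpow ((continuous_subtype_val.tendsto _).comp ht) ?_
  rcases eq_or_ne t₀ 0 with h0 | h0
  · exact Or.inl (h h0 f hf).ne'
  · exact Or.inr (lt_of_le_of_ne t₀.2.1 fun h => h0 (Subtype.ext h.symm))

variable (K) in
/-- The points of the affine line over the central point of the base. -/
def central : Set (AffineLine (archimedeanNorm K)) := nonarch K ∩ archClosure K

lemma mem_central_iff : x ∈ central K ↔ ∀ n : ℕ, x.1 ((n + 1 : ℕ) : (𝓞 K)[X]) = 1 := by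
  refine ⟨fun h n => le_antisymm (h.1 _) (h.2 _ n.succ_ne_zero),
    fun h => ⟨fun n => ?_, fun n hn => ?_⟩⟩
  · cases n with
    | zero => simp
    | succ n => exact (h n).le
  · obtain ⟨m, rfl⟩ := Nat.exists_eq_succ_of_ne_zero hn
    exact (h m).ge

/-- A continuous function on the affine line with values in the unit interval which vanishes exactly
over the central point of the base. -/
def baseDepth (x : AffineLine (archimedeanNorm K)) : ℝ :=
  ∑' n : ℕ, min 1 |x.1 ((n + 1 : ℕ) : (𝓞 K)[X]) - 1| * ((1 / 2 : ℝ) ^ (n + 1))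

lemma summable_half_pow : Summable fun n : ℕ => (1 / 2 : ℝ) ^ (n + 1) :=
  (summable_nat_add_iff 1).2 summable_geometric_two

lemma baseDepth_term_nonneg (n : ℕ) :
    0 ≤ min 1 |x.1 ((n + 1 : ℕ) : (𝓞 K)[X]) - 1| * ((1 / 2 : ℝ) ^ (n + 1)) :=
  mul_nonneg (le_min zero_le_one (abs_nonneg _)) (by positivity)

lemma baseDepth_term_le (n : ℕ) :
    min 1 |x.1 ((n + 1 : ℕ) : (𝓞 K)[X]) - 1| * ((1 / 2 : ℝ) ^ (n + 1)) ≤ (1 / 2 : ℝ) ^ (n + 1) :=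
  mul_le_of_le_one_left (by positivity) (min_le_left _ _)

lemma summable_baseDepth : Summable fun n : ℕ =>
    min 1 |x.1 ((n + 1 : ℕ) : (𝓞 K)[X]) - 1| * ((1 / 2 : ℝ) ^ (n + 1)) :=
  Summable.of_nonneg_of_le baseDepth_term_nonneg baseDepth_term_le summable_half_pow

lemma continuous_baseDepth : Continuous (baseDepth (K := K)) := by
  refine continuous_tsum (fun n => ?_) summable_half_pow fun n x => ?_
  · exact (continuous_const.min ((continuous_apply _).sub continuous_const).abs).mul
      continuous_const
  · rw [Real.norm_of_nonneg (baseDepth_term_nonneg n)]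
    exact baseDepth_term_le n

lemma baseDepth_nonneg (x : AffineLine (archimedeanNorm K)) : 0 ≤ baseDepth x :=
  tsum_nonneg baseDepth_term_nonneg

lemma baseDepth_le_one (x : AffineLine (archimedeanNorm K)) : baseDepth x ≤ 1 := by
  refine (summable_baseDepth.tsum_le_tsum baseDepth_term_le summable_half_pow).trans_eq ?_
  simp only [pow_succ]
  rw [tsum_mul_right, tsum_geometric_two]
  norm_num

lemma baseDepth_eq_zero_iff : baseDepth x = 0 ↔ x ∈ central K := by
  rw [mem_central_iff, baseDepth, ← summable_baseDepth.hasSum_iff,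
    hasSum_zero_iff_of_nonneg baseDepth_term_nonneg, funext_iff]
  refine forall_congr' fun n => ?_
  rw [Pi.zero_apply, mul_eq_zero, or_iff_left (by positivity)]
  constructor
  · intro h
    rcases min_choice 1 |x.1 ((n + 1 : ℕ) : (𝓞 K)[X]) - 1| with h' | h'
    · rw [h'] at h; exact absurd h one_ne_zero
    · rw [h', abs_eq_zero, sub_eq_zero] at h; exact h
  · intro h
    rw [h]; simp

/-- The function `baseDepth` as a map to the unit interval. -/
def depth (x : AffineLine (archimedeanNorm K)) : unitInterval :=
  ⟨baseDepth x, baseDepth_nonneg x, baseDepth_le_one x⟩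

lemma continuous_depth : Continuous (depth (K := K)) := continuous_baseDepth.subtype_mk _

lemma depth_eq_zero_iff : depth x = 0 ↔ x ∈ central K := by
  rw [← baseDepth_eq_zero_iff, Subtype.ext_iff]; rfl

/-- The end of the homotopy `spread`. -/
def spreadEnd (x : AffineLine (archimedeanNorm K)) : AffineLine (archimedeanNorm K) := spread x 1

lemma continuous_spreadEnd : Continuous (spreadEnd (K := K)) :=
  continuous_spread.comp (continuous_id.prodMk continuous_const)

lemma thicken_pos (hx : x ∈ central K) {r : ℝ} (hr : 0 < r) {f : (𝓞 K)[X]} (hf : f ≠ 0) :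
    0 < thicken x.1 (isNonarchimedean_of_mem hx.1) r hr.le f := by
  refine lt_of_lt_of_le ?_ (le_thicken x.1 (isNonarchimedean_of_mem hx.1) r hr.le f)
  rw [apply_C_eq_one hx.1 hx.2 (leadingCoeff_ne_zero.2 hf)]
  positivity

lemma spreadEnd_pos (hx : x ∈ central K) {f : (𝓞 K)[X]} (hf : f ≠ 0) : 0 < (spreadEnd x).1 f := by
  rw [spreadEnd, spread_apply_of_mem hx.1]
  exact thicken_pos hx (by norm_num) hf

/-- The homotopy which collapses the fibre over the central point of the base. -/
def collapse (x : AffineLine (archimedeanNorm K)) (t : unitInterval) :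
    AffineLine (archimedeanNorm K) := powPoint (spreadEnd x) (t ⊔ depth x)

/-- The exponent can vanish only over the central fibre, where `spreadEnd` has no kernel. -/
lemma continuous_collapse :
    Continuous fun p : AffineLine (archimedeanNorm K) × unitInterval => collapse p.1 p.2 := by
  rw [continuous_iff_continuousAt]
  rintro ⟨x, t⟩
  refine tendsto_powPoint ((continuous_spreadEnd.comp continuous_fst).tendsto (x, t))
    ((continuous_snd.max (continuous_depth.comp continuous_fst)).tendsto (x, t)) fun h f hf => ?_
  have h1 : depth x ≤ 0 := h ▸ le_sup_right
  exact spreadEnd_pos (depth_eq_zero_iff.1 (le_antisymm h1 unitInterval.nonneg')) hf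

lemma collapse_one (x : AffineLine (archimedeanNorm K)) : collapse x 1 = spreadEnd x := by
  rw [collapse, sup_eq_left.2 unitInterval.le_one', powPoint_one]

lemma collapse_zero (x : AffineLine (archimedeanNorm K)) :
    collapse x 0 = powPoint (spreadEnd x) (depth x) := by
  rw [collapse, sup_eq_right.2 unitInterval.nonneg']

lemma collapse_zero_of_mem_central (hx : x ∈ central K) : collapse x 0 = trivialPoint K := by
  rw [collapse_zero, depth_eq_zero_iff.2 hx, powPoint_zero]

lemma continuous_collapse_zero :
    Continuous fun x : AffineLine (archimedeanNorm K) => collapse x 0 :=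
  continuous_collapse.comp (continuous_id.prodMk continuous_const)

open Classical in
lemma continuous_ite_nonarch {Φ Ψ : AffineLine (archimedeanNorm K) × unitInterval →
      AffineLine (archimedeanNorm K)}
    (hΦ : ∀ p, p.1 ∈ nonarch K → ContinuousWithinAt Φ {p | p.1 ∈ nonarch K} p)
    (hΨ : ∀ p, p.1 ∈ archClosure K → ContinuousWithinAt Ψ {p | p.1 ∈ archClosure K} p)
    (h : ∀ p, p.1 ∈ central K → Φ p = Ψ p) :
    Continuous fun p => if p.1 ∈ nonarch K then Φ p else Ψ p := by
  have h1 : ContinuousOn (fun p => if p.1 ∈ nonarch K then Φ p else Ψ p)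
      {p | p.1 ∈ nonarch K} :=
    ContinuousOn.congr (fun p hp => hΦ p hp) fun p hp => if_pos hp
  have h2 : ContinuousOn (fun p => if p.1 ∈ nonarch K then Φ p else Ψ p)
      {p | p.1 ∈ archClosure K} := by
    refine ContinuousOn.congr (fun p hp => hΨ p hp) fun p hp => ?_
    by_cases hp' : p.1 ∈ nonarch K
    · exact (if_pos hp').trans (h p ⟨hp', hp⟩)
    · exact if_neg hp'
  rw [← continuousOn_univ]
  refine (h1.union_of_isClosed h2 (isClosed_nonarch.preimage continuous_fst)
    (isClosed_archClosure.preimage continuous_fst)).mono fun p _ => ?_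
  exact (Set.eq_univ_iff_forall.1 nonarch_union_archClosure p.1)

lemma powPoint_mem_central (hx : x ∈ central K) (t : unitInterval) : powPoint x t ∈ central K := by
  rw [mem_central_iff] at hx ⊢
  intro n
  rw [powPoint_apply _ _ (Nat.cast_ne_zero.2 n.succ_ne_zero), hx, Real.one_rpow]

lemma exists_tendsto_analytification {ι : Type*} (U : Ultrafilter ι)
    (y : ι → AffineLine (archimedeanNorm K))
    (h : ∀ f, ∃ c : ℝ, ∀ᶠ i in U, (y i).1 f ≤ c) :
    ∃ w : AffineLine (archimedeanNorm K), Tendsto y U (𝓝 w) := by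
  obtain ⟨w, hw⟩ := exists_seminorm_lim U (fun i => (y i).1) h
  refine ⟨mkPoint w fun a _ => le_of_tendsto' (hw (C a)) fun i => apply_C_le a, ?_⟩
  rw [tendsto_analytification_iff]
  exact hw

/-- At t₀ = 0 the power map itself may be discontinuous. Along an ultrafilter it still has a limit,
on which nonzero integers have value 1; this limit is central and `collapse` sends it to the trivial
point. -/
lemma continuousWithinAt_collapse_powPoint
    (p : AffineLine (archimedeanNorm K) × unitInterval) (hp : p.1 ∈ archClosure K) :
    ContinuousWithinAt (fun p : AffineLine (archimedeanNorm K) × unitInterval =>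
      collapse (powPoint p.1 p.2) 0) {p | p.1 ∈ archClosure K} p := by
  obtain ⟨x, t₀⟩ := p
  rw [ContinuousWithinAt, tendsto_iff_ultrafilter]
  intro U hU
  have h1 : Tendsto Prod.fst (U : Filter (AffineLine (archimedeanNorm K) × unitInterval)) (𝓝 x) :=
    (continuous_fst.tendsto (x, t₀)).mono_left (hU.trans nhdsWithin_le_nhds)
  have h2 : Tendsto Prod.snd (U : Filter (AffineLine (archimedeanNorm K) × unitInterval)) (𝓝 t₀) :=
    (continuous_snd.tendsto (x, t₀)).mono_left (hU.trans nhdsWithin_le_nhds)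
  rcases eq_or_ne t₀ 0 with rfl | ht₀
  · obtain ⟨w, hw⟩ := exists_tendsto_analytification U (fun p => powPoint p.1 p.2) fun f => by
      rcases eq_or_ne f 0 with rfl | hf
      · exact ⟨0, by simp⟩
      refine ⟨max 1 (x.1 f + 1), ?_⟩
      filter_upwards [(tendsto_analytification_iff.1 h1 f).eventually
        (gt_mem_nhds (lt_add_one _))] with p hp
      rw [powPoint_apply _ _ hf]
      calc p.1.1 f ^ (p.2 : ℝ) ≤ (max 1 (x.1 f + 1)) ^ (p.2 : ℝ) :=
            Real.rpow_le_rpow (apply_nonneg _ _) (le_max_of_le_right hp.le) p.2.2.1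
        _ ≤ (max 1 (x.1 f + 1)) ^ (1 : ℝ) :=
            Real.rpow_le_rpow_of_exponent_le (le_max_left _ _) p.2.2.2
        _ = _ := Real.rpow_one _
    have hwc : w ∈ central K := by
      rw [mem_central_iff]
      intro n
      have hn : ((n + 1 : ℕ) : (𝓞 K)[X]) ≠ 0 := Nat.cast_ne_zero.2 n.succ_ne_zero
      refine tendsto_nhds_unique (tendsto_analytification_iff.1 hw _) ?_
      simp only [powPoint_apply _ _ hn]
      have h3 := (tendsto_analytification_iff.1 h1 ((n + 1 : ℕ) : (𝓞 K)[X])).rpow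
        ((continuous_subtype_val.tendsto _).comp h2)
        (Or.inl (zero_lt_one.trans_le (hp (n + 1) n.succ_ne_zero)).ne')
      simpa using h3
    have h3 := (continuous_collapse_zero.tendsto w).comp hw
    rw [collapse_zero_of_mem_central hwc] at h3
    rw [powPoint_zero, ← powPoint_zero w,
      collapse_zero_of_mem_central (powPoint_mem_central hwc 0)]
    exact h3
  · exact (continuous_collapse_zero.tendsto _).comp
      (tendsto_powPoint h1 h2 fun h => absurd h ht₀)

open Classical in
/-- The homotopy contracting the archimedean branches. -/
def contractArch (p : AffineLine (archimedeanNorm K) × unitInterval) :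
    AffineLine (archimedeanNorm K) :=
  if p.1 ∈ nonarch K then collapse p.1 0 else collapse (powPoint p.1 p.2) 0

lemma continuous_contractArch : Continuous (contractArch (K := K)) := by
  refine continuous_ite_nonarch (Φ := fun p => collapse p.1 0)
    (Ψ := fun p => collapse (powPoint p.1 p.2) 0) (fun p _ => ?_)
    continuousWithinAt_collapse_powPoint fun p hp => ?_
  · exact (continuous_collapse_zero.comp continuous_fst).continuousWithinAt
  · rw [collapse_zero_of_mem_central hp, collapse_zero_of_mem_central (powPoint_mem_central hp _)]

lemma trivialPoint_mem_central : trivialPoint K ∈ central K := by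
  rw [mem_central_iff]
  exact fun n => trivialPoint_apply (Nat.cast_ne_zero.2 n.succ_ne_zero)

lemma contractArch_one (x : AffineLine (archimedeanNorm K)) :
    contractArch (x, 1) = collapse x 0 := by
  simp [contractArch, powPoint_one]

open Classical in
lemma contractArch_zero (x : AffineLine (archimedeanNorm K)) :
    contractArch (x, 0) = if x ∈ nonarch K then collapse x 0 else trivialPoint K := by
  simp only [contractArch, powPoint_zero, collapse_zero_of_mem_central trivialPoint_mem_central]

end Contraction

/-! ### Contracting the nonarchimedean half. -/

section NonarchimedeanContraction

variable {K : Type*} [Field K] [NumberField K] {x : AffineLine (archimedeanNorm K)}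

open Classical in
-- The power `depth` of the original point sends central points to the trivial point, so the
-- nonarchimedean half can move while the other half is constant.
lemma continuous_ite_trivialPoint {Φ : AffineLine (archimedeanNorm K) × unitInterval →
      AffineLine (archimedeanNorm K)}
    (hΦ : ∀ p, p.1 ∈ nonarch K → ContinuousWithinAt Φ {p | p.1 ∈ nonarch K} p)
    (hpos : ∀ p, p.1 ∈ central K → ∀ f : (𝓞 K)[X], f ≠ 0 → 0 < (Φ p).1 f) :
    Continuous fun p => if p.1 ∈ nonarch K then powPoint (Φ p) (depth p.1) else trivialPoint K := by
  refine continuous_ite_nonarch (Φ := fun p => powPoint (Φ p) (depth p.1))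
    (Ψ := fun _ => trivialPoint K) (fun p hp => ?_) (fun p _ => continuousWithinAt_const)
    fun p hp => ?_
  · exact tendsto_powPoint (hΦ p hp)
      ((continuous_depth.comp continuous_fst).continuousWithinAt)
      fun h f hf => hpos p (depth_eq_zero_iff.1 h) f hf
  · rw [depth_eq_zero_iff.2 hp, powPoint_zero]

open Classical in
/-- The thickening of a nonarchimedean point. -/
def thickenPoint (x : AffineLine (archimedeanNorm K)) (r : ℝ) (hr : 0 ≤ r) :
    AffineLine (archimedeanNorm K) :=
  if hx : x ∈ nonarch K then
    mkPoint (thicken x.1 (isNonarchimedean_of_mem hx) r hr) fun a _ => by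
      rw [thicken_C]; exact apply_C_le a
  else x

lemma thickenPoint_apply (hx : x ∈ nonarch K) {r : ℝ} (hr : 0 ≤ r) (f : (𝓞 K)[X]) :
    (thickenPoint x r hr).1 f = thicken x.1 (isNonarchimedean_of_mem hx) r hr f := by
  rw [thickenPoint, dif_pos hx]; rfl

/-- The radius of the smallest disc around the origin of radius at least one containing a point. -/
def radius (x : AffineLine (archimedeanNorm K)) : ℝ := max 1 (x.1 X)

lemma one_le_radius (x : AffineLine (archimedeanNorm K)) : 1 ≤ radius x := le_max_left _ _

lemma continuous_radius : Continuous (radius (K := K)) := continuous_const.max (continuous_apply _)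

/-- The radius at time `s` when growing from `1 / 4` to `radius x`. -/
def growingRadius (x : AffineLine (archimedeanNorm K)) (s : unitInterval) : ℝ :=
  (1 - s) / 4 + s * radius x

lemma growingRadius_pos (x : AffineLine (archimedeanNorm K)) (s : unitInterval) :
    0 < growingRadius x s := by
  have h1 := one_le_radius x
  have h2 := s.2.1
  have h3 := s.2.2
  unfold growingRadius
  nlinarith

lemma continuousWithinAt_thickenPoint (p : AffineLine (archimedeanNorm K) × unitInterval)
    (hp : p.1 ∈ nonarch K) :
    ContinuousWithinAt (fun p : AffineLine (archimedeanNorm K) × unitInterval =>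
      thickenPoint p.1 (growingRadius p.1 p.2) (growingRadius_pos p.1 p.2).le)
      {p | p.1 ∈ nonarch K} p := by
  rw [ContinuousWithinAt, tendsto_analytification_iff]
  intro f
  have hr : Continuous fun p : AffineLine (archimedeanNorm K) × unitInterval =>
      growingRadius p.1 p.2 := by
    have h1 := continuous_radius (K := K)
    unfold growingRadius
    fun_prop
  rw [thickenPoint_apply hp]
  refine (tendsto_congr' ?_).2 (tendsto_gaussNorm
    (v := fun p : AffineLine (archimedeanNorm K) × unitInterval => p.1.1) (w := p.1.1)
    (translation (𝓞 K) f)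
    (fun k => ((continuous_apply _).comp continuous_fst).continuousWithinAt)
    hr.continuousWithinAt)
  filter_upwards [self_mem_nhdsWithin] with q hq
  rw [thickenPoint_apply hq]
  rfl

/-- The ideal of constants of value less than one. -/
def residueIdeal (x : AffineLine (archimedeanNorm K)) (hx : x ∈ nonarch K) : Ideal (𝓞 K) where
  carrier := {a | x.1 (C a) < 1}
  zero_mem' := by simp
  add_mem' := fun {a b} ha hb => by
    change x.1 (C (a + b)) < 1
    rw [map_add]
    exact (isNonarchimedean_of_mem hx _ _).trans_lt (max_lt ha hb)
  smul_mem' := fun c a ha => by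
    change x.1 (C (c * a)) < 1
    rw [map_mul, map_mul]
    exact (mul_le_of_le_one_left (apply_nonneg _ _) (apply_C_le_one hx c)).trans_lt ha

lemma mem_residueIdeal (hx : x ∈ nonarch K) {a : 𝓞 K} :
    a ∈ residueIdeal x hx ↔ x.1 (C a) < 1 := Iff.rfl

lemma apply_C_eq_one_of_notMem (hx : x ∈ nonarch K) {a : 𝓞 K} (ha : a ∉ residueIdeal x hx) :
    x.1 (C a) = 1 := le_antisymm (apply_C_le_one hx a) (not_lt.1 ha)

instance isPrime_residueIdeal (hx : x ∈ nonarch K) : (residueIdeal x hx).IsPrime := by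
  refine ⟨fun h => ?_, fun {a b} h => ?_⟩
  · have : (1 : 𝓞 K) ∈ residueIdeal x hx := h ▸ Submodule.mem_top
    rw [mem_residueIdeal] at this
    simp at this
  · by_contra! hab
    rw [mem_residueIdeal, map_mul, map_mul, apply_C_eq_one_of_notMem hx hab.1,
      apply_C_eq_one_of_notMem hx hab.2] at h
    simp at h

/-- The deformation of the restriction of a nonarchimedean point to the constants along the branch
of the base towards the central point. -/
def raise (x : AffineLine (archimedeanNorm K)) (hx : x ∈ nonarch K) (s : unitInterval) :
    MulRingSeminorm (𝓞 K) :=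
  raiseSeminorm (P := residueIdeal x hx) (seminormComp x.1 C) (apply_C_le_one hx)
    (fun _ => (mem_residueIdeal hx).symm) s s.2.1 s.2.2

lemma raise_apply (hx : x ∈ nonarch K) (s : unitInterval) {a : 𝓞 K} (ha : a ≠ 0) :
    raise x hx s a = max (x.1 (C a)) ((s : ℝ) ^ idealOrd (residueIdeal x hx) a) :=
  raiseSeminorm_apply _ _ _ _ _ _ ha

lemma raise_le_one (hx : x ∈ nonarch K) (s : unitInterval) (a : 𝓞 K) : raise x hx s a ≤ 1 := by
  rcases eq_or_ne a 0 with rfl | ha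
  · simp
  · rw [raise_apply hx s ha]
    exact max_le (apply_C_le_one hx a) (pow_le_one₀ s.2.1 s.2.2)

lemma isNonarchimedean_raise (hx : x ∈ nonarch K) (s : unitInterval) :
    IsNonarchimedean (raise x hx s) :=
  isNonarchimedean_of_natCast_le_one fun _ => raise_le_one hx s _

lemma raise_zero (hx : x ∈ nonarch K) (a : 𝓞 K) : raise x hx 0 a = x.1 (C a) := by
  rcases eq_or_ne a 0 with rfl | ha
  · simp
  rw [raise_apply hx 0 ha]
  by_cases h : idealOrd (residueIdeal x hx) a = 0
  · have : x.1 (C a) = 1 := by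
      refine apply_C_eq_one_of_notMem hx fun hmem => ?_
      have hbot : residueIdeal x hx ≠ ⊥ := by
        intro hb
        rw [hb] at hmem
        exact ha (by simpa using hmem)
      exact (idealOrd_eq_zero_iff hbot ha).1 h hmem
    rw [h, this]; simp
  · rw [Set.Icc.coe_zero, zero_pow h, max_eq_left (apply_nonneg _ _)]

lemma raise_one (hx : x ∈ nonarch K) {a : 𝓞 K} (ha : a ≠ 0) : raise x hx 1 a = 1 := by
  rw [raise_apply hx 1 ha]
  simpa using apply_C_le_one hx a

lemma le_raise (hx : x ∈ nonarch K) (s : unitInterval) (a : 𝓞 K) :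
    x.1 (C a) ≤ raise x hx s a := by
  rcases eq_or_ne a 0 with rfl | ha
  · simp
  · rw [raise_apply hx s ha]
    exact le_max_left _ _

open Classical in
/-- The seminorm `raise`, extended by restriction to the archimedean points. -/
def raiseAt (p : AffineLine (archimedeanNorm K) × unitInterval) : MulRingSeminorm (𝓞 K) :=
  if hx : p.1 ∈ nonarch K then raise p.1 hx p.2 else seminormComp p.1.1 C

lemma raiseAt_eq {p : AffineLine (archimedeanNorm K) × unitInterval} (hp : p.1 ∈ nonarch K) :
    raiseAt p = raise p.1 hp p.2 := dif_pos hp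

/-- Finitely many generators keep value below 1 nearby, and a nonzero prime is maximal. -/
lemma eventually_residueIdeal_eq (hx : x ∈ nonarch K) (hbot : residueIdeal x hx ≠ ⊥) :
    ∀ᶠ y in 𝓝 x, ∀ hy : y ∈ nonarch K, residueIdeal y hy = residueIdeal x hx := by
  obtain ⟨S, hS⟩ := (isNoetherian_def.1 inferInstance : ∀ I : Submodule (𝓞 K) (𝓞 K), I.FG)
    (residueIdeal x hx)
  have hmax : (residueIdeal x hx).IsMaximal := (isPrime_residueIdeal hx).isMaximal hbot
  have : ∀ᶠ y in 𝓝 x, ∀ a ∈ S, y.1 (C a) < 1 := by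
    rw [Filter.eventually_all_finset]
    intro a ha
    have hax : x.1 (C a) < 1 := by
      rw [← mem_residueIdeal hx, ← hS]
      exact Submodule.subset_span ha
    exact (continuous_apply (C a)).continuousAt.eventually (gt_mem_nhds hax)
  filter_upwards [this] with y hyS hy
  refine (hmax.eq_of_le (isPrime_residueIdeal hy).ne_top ?_).symm
  rw [← hS]
  exact Submodule.span_le.2 fun a ha => (mem_residueIdeal hy).2 (hyS a ha)

/-- For a nonzero a in the residue ideal, that ideal is locally constant. Otherwise |a| = 1 and the
value is squeezed between |a| and 1; this also covers the central fibre, where the residue ideal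
need not be locally constant. -/
lemma continuousWithinAt_raiseAt (a : 𝓞 K) (p : AffineLine (archimedeanNorm K) × unitInterval)
    (hp : p.1 ∈ nonarch K) :
    ContinuousWithinAt (fun q => raiseAt q a) {p | p.1 ∈ nonarch K} p := by
  have heq : ∀ {q : AffineLine (archimedeanNorm K) × unitInterval} (hq : q.1 ∈ nonarch K),
      raiseAt q a = raise q.1 hq q.2 a := fun hq => by rw [raiseAt_eq hq]
  have hval : Continuous fun q : AffineLine (archimedeanNorm K) × unitInterval => q.1.1 (C a) :=
    (continuous_apply _).comp continuous_fst
  rcases eq_or_ne a 0 with rfl | ha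
  · refine (continuousWithinAt_const (b := (0 : ℝ))).congr (fun q hq => ?_) ?_
    · rw [heq hq, map_zero]
    · rw [heq hp, map_zero]
  by_cases hmem : a ∈ residueIdeal p.1 hp
  · have hbot : residueIdeal p.1 hp ≠ ⊥ := by
      intro hb
      rw [hb] at hmem
      exact ha (by simpa using hmem)
    have h1 : ContinuousWithinAt (fun q : AffineLine (archimedeanNorm K) × unitInterval =>
        max (q.1.1 (C a)) ((q.2 : ℝ) ^ idealOrd (residueIdeal p.1 hp) a))
        {p | p.1 ∈ nonarch K} p :=
      (hval.max ((continuous_subtype_val.comp continuous_snd).pow _)).continuousWithinAt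
    refine h1.congr_of_eventuallyEq ?_ ?_
    · have h2 := (continuous_fst.tendsto p).eventually (eventually_residueIdeal_eq hp hbot)
      filter_upwards [self_mem_nhdsWithin, nhdsWithin_le_nhds h2] with q hq hq2
      rw [heq hq, raise_apply hq q.2 ha, hq2 hq]
    · rw [heq hp, raise_apply hp p.2 ha]
  · have h1 := apply_C_eq_one_of_notMem hp hmem
    have h2 : raiseAt p a = 1 := by
      rw [heq hp]
      exact le_antisymm (raise_le_one hp _ _) (h1 ▸ le_raise hp _ _)
    rw [ContinuousWithinAt, h2]
    have h3 : Tendsto (fun q : AffineLine (archimedeanNorm K) × unitInterval => q.1.1 (C a))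
        (𝓝[{p | p.1 ∈ nonarch K}] p) (𝓝 1) := by
      rw [← h1]
      exact hval.continuousWithinAt
    refine tendsto_of_tendsto_of_tendsto_of_le_of_le' h3 tendsto_const_nhds ?_ ?_
    · filter_upwards [self_mem_nhdsWithin] with q hq
      rw [heq hq]
      exact le_raise hq _ _
    · filter_upwards [self_mem_nhdsWithin] with q hq
      rw [heq hq]
      exact raise_le_one hq _ _

/-- The radius at time `s` when shrinking from `radius x` to `1`. -/
def shrinkingRadius (x : AffineLine (archimedeanNorm K)) (s : unitInterval) : ℝ :=
  (1 - s) * radius x + s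

lemma shrinkingRadius_pos (x : AffineLine (archimedeanNorm K)) (s : unitInterval) :
    0 < shrinkingRadius x s := by
  have h1 := one_le_radius x
  have h2 := s.2.1
  have h3 := s.2.2
  unfold shrinkingRadius
  nlinarith

open Classical in
/-- The Gauss point over the deformation of the restriction of a point to the constants. -/
def raisedGaussPoint (p : AffineLine (archimedeanNorm K) × unitInterval) :
    AffineLine (archimedeanNorm K) :=
  if hx : p.1 ∈ nonarch K then
    mkPoint (gaussSeminorm (raise p.1 hx p.2) (isNonarchimedean_raise hx p.2)
      (shrinkingRadius p.1 p.2) (shrinkingRadius_pos p.1 p.2).le) fun a ha => by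
        change (C a).gaussNorm _ _ ≤ _
        rw [gaussNorm_C]
        exact (raise_le_one hx _ _).trans (one_le_archimedeanNorm ha)
  else p.1

lemma raisedGaussPoint_apply {p : AffineLine (archimedeanNorm K) × unitInterval}
    (hx : p.1 ∈ nonarch K) (f : (𝓞 K)[X]) :
    (raisedGaussPoint p).1 f = f.gaussNorm (raise p.1 hx p.2) (shrinkingRadius p.1 p.2) := by
  rw [raisedGaussPoint, dif_pos hx]; rfl

lemma raisedGaussPoint_pos {p : AffineLine (archimedeanNorm K) × unitInterval}
    (hp : p.1 ∈ central K) {f : (𝓞 K)[X]} (hf : f ≠ 0) : 0 < (raisedGaussPoint p).1 f := by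
  rw [raisedGaussPoint_apply hp.1]
  refine lt_of_lt_of_le ?_ (le_gaussNorm _ f (shrinkingRadius_pos p.1 p.2).le f.natDegree)
  have h1 := le_raise hp.1 p.2 f.leadingCoeff
  rw [apply_C_eq_one hp.1 hp.2 (leadingCoeff_ne_zero.2 hf)] at h1
  exact mul_pos (zero_lt_one.trans_le h1) (pow_pos (shrinkingRadius_pos p.1 p.2) _)

lemma continuousWithinAt_raisedGaussPoint (p : AffineLine (archimedeanNorm K) × unitInterval)
    (hp : p.1 ∈ nonarch K) :
    ContinuousWithinAt raisedGaussPoint {p | p.1 ∈ nonarch K} p := by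
  rw [ContinuousWithinAt, tendsto_analytification_iff]
  intro f
  have hr : Continuous fun p : AffineLine (archimedeanNorm K) × unitInterval =>
      shrinkingRadius p.1 p.2 := by
    have h1 := continuous_radius (K := K)
    unfold shrinkingRadius
    fun_prop
  rw [raisedGaussPoint_apply hp]
  refine (tendsto_congr' ?_).2 (tendsto_gaussNorm
    (v := raiseAt) (w := raise p.1 hp p.2) f (fun k => ?_) hr.continuousWithinAt)
  · filter_upwards [self_mem_nhdsWithin] with q hq
    rw [raisedGaussPoint_apply hq, raiseAt_eq hq]
  · have := continuousWithinAt_raiseAt (f.coeff k) p hp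
    rwa [ContinuousWithinAt, raiseAt_eq hp] at this

end NonarchimedeanContraction

/-! ### Composing the homotopies. -/

section Contractible

variable {K : Type*} [Field K] [NumberField K]

lemma homotopic_of_continuous {X Y : Type*} [TopologicalSpace X] [TopologicalSpace Y]
    {F : X × unitInterval → Y} (hF : Continuous F) (f g : C(X, Y)) (hf : ∀ x, F (x, 0) = f x)
    (hg : ∀ x, F (x, 1) = g x) : f.Homotopic g :=
  ⟨{ toFun := fun p => F (p.2, p.1)
     continuous_toFun := hF.comp continuous_swap
     map_zero_left := hf
     map_one_left := hg }⟩

open Classical in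
theorem contractibleSpace_affineLine : ContractibleSpace (AffineLine (archimedeanNorm K)) := by
  rw [contractible_iff_id_nullhomotopic]
  let S := AffineLine (archimedeanNorm K)
  let f₁ : C(S, S) := ⟨spreadEnd, continuous_spreadEnd⟩
  let f₂ : C(S, S) := ⟨fun x => collapse x 0, continuous_collapse_zero⟩
  let f₃ : C(S, S) := ⟨fun x => contractArch (x, 0),
    continuous_contractArch.comp (continuous_id.prodMk continuous_const)⟩
  have hF₄ := continuous_ite_trivialPoint (K := K) continuousWithinAt_thickenPoint
    fun p hp f hf => by
      rw [thickenPoint_apply hp.1]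
      exact thicken_pos hp (growingRadius_pos _ _) hf
  have hF₅ := continuous_ite_trivialPoint (K := K) continuousWithinAt_raisedGaussPoint
    fun p hp f hf => raisedGaussPoint_pos hp hf
  let f₄ : C(S, S) := ⟨_, hF₅.comp (continuous_id.prodMk (continuous_const (y := 0)))⟩
  have h₁ : (ContinuousMap.id S).Homotopic f₁ :=
    homotopic_of_continuous continuous_spread _ _ spread_zero fun _ => rfl
  have h₂ : f₂.Homotopic f₁ :=
    homotopic_of_continuous continuous_collapse _ _ (fun _ => rfl) collapse_one
  have h₃ : f₃.Homotopic f₂ :=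
    homotopic_of_continuous continuous_contractArch _ _ (fun _ => rfl) contractArch_one
  have h₄ : f₃.Homotopic f₄ := by
    refine homotopic_of_continuous hF₄ _ _ (fun x => ?_) fun x => ?_
    -- The growing radius starts at 1/4, where `spread` stops.
    · change _ = contractArch (x, 0)
      rw [contractArch_zero]
      by_cases hx : x ∈ nonarch K
      · rw [if_pos hx, if_pos hx, collapse_zero]
        congr 1
        refine Subtype.ext (MulRingSeminorm.ext fun f => ?_)
        rw [thickenPoint_apply hx, spreadEnd, spread_apply_of_mem hx, thicken_apply, thicken_apply]
        simp [growingRadius]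
      · rw [if_neg hx, if_neg hx]
    · change _ = if x ∈ nonarch K then _ else _
      by_cases hx : x ∈ nonarch K
      · rw [if_pos hx, if_pos hx]
        congr 1
        refine Subtype.ext (MulRingSeminorm.ext fun f => ?_)
        -- The radius has reached |T|, so the disc is centred at the origin and depends on x only
        -- through its constants and its radius.
        have h0 : x.1 X ≤ growingRadius x 1 := by simp [growingRadius, radius]
        have hraise : raise x hx 0 = seminormComp x.1 C :=
          MulRingSeminorm.ext fun a => raise_zero hx a
        have hrad : growingRadius x 1 = shrinkingRadius x 0 := by
          simp [growingRadius, shrinkingRadius]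
        rw [thickenPoint_apply hx, thicken_eq_gaussNorm _ _ _ h0]
        refine Eq.trans ?_ (raisedGaussPoint_apply (p := (x, 0)) hx f).symm
        rw [hraise, hrad]
      · rw [if_neg hx, if_neg hx]
  have h₅ : f₄.Homotopic (ContinuousMap.const S (trivialPoint K)) := by
    refine homotopic_of_continuous hF₅ _ _ (fun _ => rfl) fun x => ?_
    by_cases hx : x ∈ nonarch K
    · rw [if_pos hx]
      refine ext_of_ne_zero fun f hf => ?_
      -- The Gauss norm of radius 1 over the trivial norm is trivial: no coefficient exceeds 1, and
      -- the leading one attains it.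
      have h0 : (raisedGaussPoint (x, 1)).1 f = 1 := by
        rw [raisedGaussPoint_apply (p := (x, 1)) hx]
        have hrad : shrinkingRadius x 1 = 1 := by simp [shrinkingRadius]
        apply le_antisymm
        · refine (gaussNorm_le_iff _ (shrinkingRadius_pos x 1).le f).2 fun i => ?_
          rw [hrad, one_pow, mul_one]
          exact raise_le_one hx 1 _
        · have := le_gaussNorm (raise x hx 1) f (shrinkingRadius_pos x 1).le f.natDegree
          have e : raise x hx 1 (f.coeff f.natDegree) * shrinkingRadius x 1 ^ f.natDegree = 1 := by
            rw [hrad, one_pow, mul_one]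
            exact raise_one hx (leadingCoeff_ne_zero.2 hf)
          rwa [e] at this
      rw [powPoint_apply _ _ hf, h0, Real.one_rpow]
      exact (trivialPoint_apply hf).symm
    · rw [if_neg hx]; rfl
  exact ⟨_, h₁.trans (h₂.symm.trans (h₃.symm.trans (h₄.trans h₅)))⟩

end Contractible

end BerkovichLine

end

end

theorem theoremD (K : Type*) [Field K] [NumberField K] :
    ContractibleSpace (BerkovichLine.AffineLine (BerkovichLine.archimedeanNorm K)) :=
  BerkovichLine.contractibleSpace_affineLine
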